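/- Let $k$ be a differential field of characteristic $0$ whose field of constants $C$ is algebraically closed, and assume that $k$ is a $C_1$-field (every homogeneous polynomial over $k$ of degree $d\ge 1$ in $n>d$ variables has a non-trivial zero in $k^n$). Let $K/k$ be a Galois extension, finite or infinite, where $K$ carries the derivation that extends the derivation of $k$. For a differential module $A$ over $K$ and $\sigma\in \mathrm{Gal}(K/k)$, let ${}^\sigma A$ be the twist of $A$: the same additive group and the same $\partial$, with scalar multiplication $\lambda * a=(\sigma^{-1}\lambda)\cdot a$. Let $H(K)$ be the set of isomorphism classes of one-dimensional differential modules $A$ over $K$ with ${}^\sigma A\cong A$ for all $\sigma\in\mathrm{Gal}(K/k)$. It is a group under the tensor product. Let $h(K)$ be the set of classes of the modules $K\otimes_k B$, where $B$ is a one-dimensional differential module over $k$; it is a subgroup of $H(K)$. Then there is a canonical isomorphism $$H(K)/h(K)\;\longrightarrow\; H^2(\mathrm{Gal}(K/k),C^*),$$ where $H^2$ denotes continuous cohomology (continuous $2$-cocycles modulo coboundaries of continuous $1$-cochains) of the profinite group $\mathrm{Gal}(K/k)$ acting trivially on the discrete group $C^*$. It is characterized as follows. For every $A$ with class in $H(K)$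 there are a continuous $2$-cocycle $c$ and bijective $\sigma$-linear maps $\Phi(\sigma):A\to A$ commuting with $\partial$ ($\sigma\in\mathrm{Gal}(K/k)$), with $\sigma\mapsto\Phi(\sigma)a$ locally constant for each $a\in A$, such that $$\Phi(\sigma\tau)=c(\sigma,\tau)\,\Phi(\sigma)\,\Phi(\tau)\qquad\text{for all }\sigma,\tau\in\mathrm{Gal}(K/k);$$ and for every such $c$ the isomorphism sends the class of $A$ to the class of $c$. -/

import Mathlib

open scoped Differential TensorProduct

universe u v w w₁ w₂ w₃ w₄

/-- A field `F` is a `C₁`-field if every homogeneous polynomial over `F` of degree `d ≥ 1` in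
`n > d` variables has a non-trivial zero in `F ^ n`. -/
def IsC1Field (F : Type u) [Field F] : Prop :=
  ∀ (n d : ℕ) (p : MvPolynomial (Fin n) F), p.IsHomogeneous d → 1 ≤ d → d < n →
    ∃ x : Fin n → F, x ≠ 0 ∧ MvPolynomial.eval x p = 0

/-- The field of constants of a differential field. -/
def constantField (k : Type u) [Field k] [Differential k] : Subfield k where
  carrier := {x | x′ = 0}
  mul_mem' := by
    intro a b ha hb
    simp only [Set.mem_ofPred_eq] at *
    simp [ha, hb]
  one_mem' := by simp
  add_mem' := by
    intro a b ha hb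
    simp only [Set.mem_ofPred_eq] at *
    simp [ha, hb]
  zero_mem' := by simp
  neg_mem' := by
    intro a ha
    simp only [Set.mem_ofPred_eq] at *
    simp [ha]
  inv_mem' := by
    intro a ha
    simp only [Set.mem_ofPred_eq] at *
    simp [Derivation.leibniz_inv, ha]

/-- A differential module over a differential field `K`: a `K`-vector space with an additive map
`∂` satisfying `∂ (a m) = a' m + a ∂ m`. -/
structure DifferentialModule (K : Type u) [Field K] [Differential K] where
  carrier : Type w
  [addCommGroup : AddCommGroup carrier]
  [module : Module K carrier]
  D : carrier →+ carrier
  leibniz : ∀ (a : K) (m : carrier), D (a • m) = a′ • m + a • D m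

namespace DifferentialModule

instance (K : Type u) [Field K] [Differential K] :
    CoeSort (DifferentialModule.{u, w} K) (Type w) := ⟨carrier⟩

attribute [instance] addCommGroup module

section Basic

variable {K : Type u} [Field K] [Differential K]

/-- Isomorphisms of differential modules: `K`-linear bijections commuting with `∂`. -/
structure Iso (A : DifferentialModule.{u, w₁} K) (B : DifferentialModule.{u, w₂} K) where
  toEquiv : A ≃ₗ[K] B
  map_D : ∀ a, toEquiv (A.D a) = B.D (toEquiv a)

/-- The identity isomorphism. -/
def Iso.refl (A : DifferentialModule.{u, w₁} K) : Iso A A := ⟨LinearEquiv.refl K A, fun _ => rfl⟩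

/-- The inverse isomorphism. -/
def Iso.symm {A : DifferentialModule.{u, w₁} K} {B : DifferentialModule.{u, w₂} K}
    (f : Iso A B) : Iso B A :=
  ⟨f.toEquiv.symm, fun b => f.toEquiv.injective (by simp [f.map_D])⟩

/-- Composition of isomorphisms. -/
def Iso.trans {A : DifferentialModule.{u, w₁} K} {B : DifferentialModule.{u, w₂} K}
    {C : DifferentialModule.{u, w₃} K} (f : Iso A B) (g : Iso B C) : Iso A C :=
  ⟨f.toEquiv.trans g.toEquiv, fun a => by simp [f.map_D, g.map_D]⟩

/-- The map `a ⊗ b ↦ ∂ a ⊗ b + a ⊗ ∂ b` on a tensor product. -/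
noncomputable def tensorD (A : DifferentialModule.{u, w₁} K) (B : DifferentialModule.{u, w₂} K) :
    A ⊗[K] B →+ A ⊗[K] B :=
  TensorProduct.liftAddHom
    (AddMonoidHom.mk' (fun a => AddMonoidHom.mk' (fun b => A.D a ⊗ₜ[K] b + a ⊗ₜ[K] B.D b)
      (by intro b b'; simp only [map_add, TensorProduct.tmul_add]; abel))
      (by
        intro a a'
        ext b
        simp only [map_add, TensorProduct.add_tmul, AddMonoidHom.mk'_apply,
          AddMonoidHom.add_apply]
        abel))
    (by
      intro r a b
      simp only [AddMonoidHom.mk'_apply, A.leibniz, B.leibniz, TensorProduct.add_tmul,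
        TensorProduct.tmul_add, TensorProduct.smul_tmul]
      abel)

theorem tensorD_tmul (A : DifferentialModule.{u, w₁} K) (B : DifferentialModule.{u, w₂} K)
    (a : A) (b : B) : tensorD A B (a ⊗ₜ[K] b) = A.D a ⊗ₜ[K] b + a ⊗ₜ[K] B.D b := rfl

theorem tensorD_leibniz (A : DifferentialModule.{u, w₁} K) (B : DifferentialModule.{u, w₂} K)
    (r : K) (x : A ⊗[K] B) : tensorD A B (r • x) = r′ • x + r • tensorD A B x := by
  induction x using TensorProduct.induction_on with
  | zero => simp
  | add x y hx hy => rw [smul_add, map_add, hx, hy, map_add, smul_add, smul_add]; abel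
  | tmul a b =>
    rw [TensorProduct.smul_tmul', tensorD_tmul, tensorD_tmul, A.leibniz, TensorProduct.add_tmul,
      smul_add, TensorProduct.smul_tmul', TensorProduct.smul_tmul', TensorProduct.smul_tmul',
      add_assoc]

/-- The tensor product of differential modules, with
`∂ (a ⊗ b) = ∂ a ⊗ b + a ⊗ ∂ b`. -/
noncomputable def tensor (A : DifferentialModule.{u, w₁} K) (B : DifferentialModule.{u, w₂} K) :
    DifferentialModule.{u, max w₁ w₂} K where
  carrier := A ⊗[K] B
  D := tensorD A B
  leibniz := tensorD_leibniz A B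

theorem tensor_D_tmul (A : DifferentialModule.{u, w₁} K) (B : DifferentialModule.{u, w₂} K)
    (a : A) (b : B) :
    (tensor A B).D (a ⊗ₜ[K] b) = A.D a ⊗ₜ[K] b + a ⊗ₜ[K] B.D b := rfl

theorem congr_tensorD {A : DifferentialModule.{u, w₁} K} {A' : DifferentialModule.{u, w₂} K}
    {B : DifferentialModule.{u, w₃} K} {B' : DifferentialModule.{u, w₄} K}
    (f : Iso A A') (g : Iso B B') (x : A ⊗[K] B) :
    TensorProduct.congr f.toEquiv g.toEquiv (tensorD A B x) =
      tensorD A' B' (TensorProduct.congr f.toEquiv g.toEquiv x) := by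
  induction x using TensorProduct.induction_on with
  | zero => simp only [map_zero]
  | add x y hx hy => simp only [map_add, hx, hy]
  | tmul a b =>
    rw [tensorD_tmul, map_add, TensorProduct.congr_tmul, TensorProduct.congr_tmul,
      TensorProduct.congr_tmul, tensorD_tmul, f.map_D, g.map_D]

/-- The tensor product is functorial for isomorphisms. -/
noncomputable def Iso.tensor {A : DifferentialModule.{u, w₁} K} {A' : DifferentialModule.{u, w₂} K}
    {B : DifferentialModule.{u, w₃} K} {B' : DifferentialModule.{u, w₄} K}
    (f : Iso A A') (g : Iso B B') : Iso (A.tensor B) (A'.tensor B') where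
  toEquiv := TensorProduct.congr f.toEquiv g.toEquiv
  map_D := congr_tensorD f g

/-- The map `x ↦ x' + x u`. -/
def ofElemD (u : K) : K →+ K :=
  AddMonoidHom.mk' (fun x => x′ + x * u) (by intro x y; simp only [map_add]; ring)

theorem ofElemD_apply (u x : K) : ofElemD u x = x′ + x * u := rfl

theorem ofElemD_leibniz (u a x : K) : ofElemD u (a • x) = a′ • x + a • ofElemD u x := by
  simp only [ofElemD_apply, smul_eq_mul, Derivation.leibniz]
  ring

/-- The module `K e` with `∂ e = u e`. -/
def ofElem (u : K) : DifferentialModule.{u, u} K where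
  carrier := K
  D := ofElemD u
  leibniz := ofElemD_leibniz u

theorem finrank_ofElem (u : K) : Module.finrank K (ofElem u) = 1 := Module.finrank_self K

theorem exists_iso_ofElem (A : DifferentialModule.{u, w} K) (hA : Module.finrank K A = 1) :
    ∃ u : K, Nonempty (Iso (ofElem u) A) := by
  obtain ⟨e, he, hspan⟩ := finrank_eq_one_iff'.1 hA
  obtain ⟨u, hu⟩ := hspan (A.D e)
  let f : K →ₗ[K] A := LinearMap.toSpanSingleton K A e
  have hf : Function.Bijective f := by
    refine ⟨?_, fun a => ?_⟩
    · rw [← LinearMap.ker_eq_bot, LinearMap.ker_toSpanSingleton K he]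
    · obtain ⟨c, hc⟩ := hspan a
      exact ⟨c, by simpa [f] using hc⟩
  have hD (x : K) : f (ofElemD u x) = A.D (f x) := by
    simp only [f, LinearMap.toSpanSingleton_apply, A.leibniz, ← hu, ofElemD_apply, add_smul,
      mul_smul]
  exact ⟨u, ⟨⟨LinearEquiv.ofBijective f hf, hD⟩⟩⟩

theorem lid_tensorD {A : DifferentialModule.{u, w₁} K} {B : DifferentialModule.{u, w₂} K} {u v : K}
    (f : A ≃ₗ[K] K) (hf : ∀ a, f (A.D a) = ofElemD u (f a))
    (g : B ≃ₗ[K] K) (hg : ∀ b, g (B.D b) = ofElemD v (g b)) (x : A ⊗[K] B) :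
    ((TensorProduct.congr f g).trans (TensorProduct.lid K K)) (tensorD A B x) =
      ofElemD (u + v) (((TensorProduct.congr f g).trans (TensorProduct.lid K K)) x) := by
  induction x using TensorProduct.induction_on with
  | zero => simp only [map_zero]
  | add x y hx hy => simp only [map_add, hx, hy]
  | tmul a b =>
    simp only [tensorD_tmul, map_add, LinearEquiv.trans_apply, TensorProduct.congr_tmul,
      TensorProduct.lid_tmul, hf, hg, ofElemD_apply, Derivation.leibniz, smul_eq_mul]
    ring

/-- The identity map from `K e` to `K`. -/
def ofElemEquiv (u : K) : ofElem u ≃ₗ[K] K := LinearEquiv.refl K K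

/-- `K e₁ ⊗ K e₂` with `∂ e₁ = u e₁`, `∂ e₂ = v e₂` is `K e` with `∂ e = (u + v) e`. -/
noncomputable def tensorOfElem (u v : K) : Iso ((ofElem u).tensor (ofElem v)) (ofElem (u + v)) where
  toEquiv := (TensorProduct.congr (ofElemEquiv u) (ofElemEquiv v)).trans (TensorProduct.lid K K)
  map_D := lid_tensorD (ofElemEquiv u) (fun _ => rfl) (ofElemEquiv v) (fun _ => rfl)

end Basic

section ClassGroup

variable (K : Type u) [Field K] [Differential K]

/-- Isomorphism of one-dimensional differential modules. -/
def rankOneSetoid : Setoid {A : DifferentialModule.{u, u} K // Module.finrank K A = 1} where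
  r A B := Nonempty (Iso A.1 B.1)
  iseqv :=
    { refl := fun A => ⟨Iso.refl A.1⟩
      symm := fun ⟨f⟩ => ⟨f.symm⟩
      trans := fun ⟨f⟩ ⟨g⟩ => ⟨f.trans g⟩ }

/-- The set of isomorphism classes of one-dimensional differential modules over `K`. -/
def RankOneClass : Type (u + 1) := Quotient (rankOneSetoid K)

variable {K}

/-- The isomorphism class of a one-dimensional differential module. -/
def rankOneClass (A : DifferentialModule.{u, u} K) (hA : Module.finrank K A = 1) :
    RankOneClass K :=
  Quotient.mk (rankOneSetoid K) ⟨A, hA⟩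

theorem rankOneClass_eq_iff {A B : DifferentialModule.{u, u} K} {hA : Module.finrank K A = 1}
    {hB : Module.finrank K B = 1} :
    rankOneClass A hA = rankOneClass B hB ↔ Nonempty (Iso A B) :=
  Quotient.eq (r := rankOneSetoid K)

theorem finrank_tensor {A B : DifferentialModule.{u, u} K} (hA : Module.finrank K A = 1)
    (hB : Module.finrank K B = 1) : Module.finrank K (A.tensor B) = 1 := by
  have h := Module.finrank_tensorProduct (R := K) (S := K) (M := A) (M' := B)
  rw [hA, hB] at h
  exact h

/-- The product of isomorphism classes, given by the tensor product of differential modules. -/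
noncomputable instance : Mul (RankOneClass K) where
  mul := Quotient.map₂ (fun A B => ⟨A.1.tensor B.1, finrank_tensor A.2 B.2⟩)
    (fun _ _ ⟨f⟩ _ _ ⟨g⟩ => ⟨f.tensor g⟩)

theorem rankOneClass_mul (A B : DifferentialModule.{u, u} K) (hA : Module.finrank K A = 1)
    (hB : Module.finrank K B = 1) :
    rankOneClass A hA * rankOneClass B hB =
      rankOneClass (A.tensor B) (finrank_tensor hA hB) := rfl

/-- The class of `K e` with `∂ e = u e`. -/
def elemClass (u : K) : RankOneClass K := rankOneClass (ofElem u) (finrank_ofElem u)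

theorem elemClass_surjective : Function.Surjective (elemClass (K := K)) := by
  intro x
  induction x using Quotient.inductionOn with
  | h A =>
    obtain ⟨u, hu⟩ := exists_iso_ofElem A.1 A.2
    exact ⟨u, rankOneClass_eq_iff.2 hu⟩

theorem elemClass_mul (u v : K) : elemClass u * elemClass v = elemClass (u + v) :=
  rankOneClass_eq_iff.2 ⟨tensorOfElem u v⟩

/-- The monoid of isomorphism classes of one-dimensional differential modules over `K`, under the
tensor product; the unit is the trivial module `K e` with `∂ e = 0`. -/
noncomputable instance : CommMonoid (RankOneClass K) where
  mul := (· * ·)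
  one := elemClass 0
  mul_assoc := by
    intro a b c
    obtain ⟨a, rfl⟩ := elemClass_surjective a
    obtain ⟨b, rfl⟩ := elemClass_surjective b
    obtain ⟨c, rfl⟩ := elemClass_surjective c
    simp only [elemClass_mul, add_assoc]
  one_mul := by
    intro a
    obtain ⟨a, rfl⟩ := elemClass_surjective a
    change elemClass 0 * elemClass a = elemClass a
    rw [elemClass_mul, zero_add]
  mul_one := by
    intro a
    obtain ⟨a, rfl⟩ := elemClass_surjective a
    change elemClass a * elemClass 0 = elemClass a
    rw [elemClass_mul, add_zero]
  mul_comm := by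
    intro a b
    obtain ⟨a, rfl⟩ := elemClass_surjective a
    obtain ⟨b, rfl⟩ := elemClass_surjective b
    simp only [elemClass_mul, add_comm]

theorem elemClass_zero : elemClass (0 : K) = 1 := rfl

/-- Every class is invertible, so the classes form a group. -/
noncomputable instance : CommGroup (RankOneClass K) :=
  commGroupOfIsUnit (fun a => by
    obtain ⟨a, rfl⟩ := elemClass_surjective a
    refine ⟨⟨elemClass a, elemClass (-a), ?_, ?_⟩, rfl⟩
    · rw [elemClass_mul, add_neg_cancel, elemClass_zero]
    · rw [elemClass_mul, neg_add_cancel, elemClass_zero])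

theorem elemClass_neg (u : K) : elemClass (-u) = (elemClass u)⁻¹ := by
  rw [eq_inv_iff_mul_eq_one, elemClass_mul, neg_add_cancel, elemClass_zero]

end ClassGroup

theorem twistOfElem_smul {k : Type u} {K : Type v} [Field k] [Field K] [Algebra k K]
    (σ : Gal(K/k)) (x a : K) : σ ((σ⁻¹ : Gal(K/k)) x * a) = x * σ a := by
  rw [map_mul]
  congr 1
  exact σ.apply_symm_apply x

section Descent

variable {k : Type u} {K : Type v} [Field k] [Field K] [Differential k] [Differential K]
  [Algebra k K] [DifferentialAlgebra k K]

/-- The map `x ⊗ b ↦ x' ⊗ b + x ⊗ ∂ b` on the base change of `B`. -/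
noncomputable def baseChangeD (K : Type v) [Field K] [Differential K] [Algebra k K]
    [DifferentialAlgebra k K] (B : DifferentialModule.{u, w} k) : K ⊗[k] B →+ K ⊗[k] B :=
  TensorProduct.liftAddHom
    (AddMonoidHom.mk' (fun x => AddMonoidHom.mk' (fun b => (x′ : K) ⊗ₜ[k] b + x ⊗ₜ[k] B.D b)
      (by intro b b'; simp only [map_add, TensorProduct.tmul_add]; abel))
      (by
        intro x y
        ext b
        simp only [map_add, TensorProduct.add_tmul, AddMonoidHom.mk'_apply,
          AddMonoidHom.add_apply]
        abel))
    (by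
      intro r x b
      have h : (r • x : K)′ = r′ • x + r • x′ := by
        rw [Algebra.smul_def r x, Algebra.smul_def r, Algebra.smul_def r′, Derivation.leibniz,
          deriv_algebraMap, smul_eq_mul, smul_eq_mul]
        ring
      simp only [AddMonoidHom.mk'_apply, h, B.leibniz, TensorProduct.add_tmul,
        TensorProduct.tmul_add, TensorProduct.smul_tmul]
      abel)

theorem baseChangeD_tmul (B : DifferentialModule.{u, w} k) (x : K) (b : B) :
    baseChangeD K B (x ⊗ₜ[k] b) = (x′ : K) ⊗ₜ[k] b + x ⊗ₜ[k] B.D b := rfl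

theorem baseChangeD_leibniz (B : DifferentialModule.{u, w} k) (r : K) (x : K ⊗[k] B) :
    baseChangeD K B (r • x) = r′ • x + r • baseChangeD K B x := by
  induction x using TensorProduct.induction_on with
  | zero => simp
  | add x y hx hy => rw [smul_add, map_add, hx, hy, map_add, smul_add, smul_add]; abel
  | tmul a b =>
    rw [TensorProduct.smul_tmul', baseChangeD_tmul, baseChangeD_tmul, smul_add,
      TensorProduct.smul_tmul', TensorProduct.smul_tmul', TensorProduct.smul_tmul',
      smul_eq_mul, smul_eq_mul, smul_eq_mul, Derivation.leibniz, TensorProduct.add_tmul,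
      smul_eq_mul, smul_eq_mul, mul_comm a]
    abel

/-- The base change `K ⊗ B` of a differential module over `k`, with
`∂ (x ⊗ b) = x' ⊗ b + x ⊗ ∂ b`. -/
noncomputable def baseChange (K : Type v) [Field K] [Differential K] [Algebra k K]
    [DifferentialAlgebra k K] (B : DifferentialModule.{u, w} k) :
    DifferentialModule.{v, max v w} K where
  carrier := K ⊗[k] B
  D := baseChangeD K B
  leibniz := baseChangeD_leibniz B

theorem baseChange_D_tmul (B : DifferentialModule.{u, w} k) (x : K) (b : B) :
    (baseChange K B).D (x ⊗ₜ[k] b) = (x′ : K) ⊗ₜ[k] b + x ⊗ₜ[k] B.D b := rfl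

theorem baseChange_baseChangeD {A : DifferentialModule.{u, w₁} k}
    {B : DifferentialModule.{u, w₂} k} (f : Iso A B) (x : K ⊗[k] A) :
    f.toEquiv.baseChange k K A B (baseChangeD K A x) =
      baseChangeD K B (f.toEquiv.baseChange k K A B x) := by
  induction x using TensorProduct.induction_on with
  | zero => simp only [map_zero]
  | add x y hx hy => simp only [map_add, hx, hy]
  | tmul a b =>
    rw [baseChangeD_tmul, map_add, LinearEquiv.baseChange_tmul, LinearEquiv.baseChange_tmul,
      LinearEquiv.baseChange_tmul, baseChangeD_tmul, f.map_D]

/-- Base change is functorial for isomorphisms. -/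
noncomputable def Iso.baseChange {A : DifferentialModule.{u, w₁} k}
    {B : DifferentialModule.{u, w₂} k} (f : Iso A B) :
    Iso (A.baseChange K) (B.baseChange K) where
  toEquiv := f.toEquiv.baseChange k K A B
  map_D := baseChange_baseChangeD f

theorem rid_baseChangeD {B : DifferentialModule.{u, w} k} {u : k}
    (f : B ≃ₗ[k] k) (hf : ∀ b, f (B.D b) = ofElemD u (f b)) (x : K ⊗[k] B) :
    ((f.baseChange k K B k).trans (TensorProduct.AlgebraTensorModule.rid k K K))
        (baseChangeD K B x) =
      ofElemD (algebraMap k K u)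
        (((f.baseChange k K B k).trans (TensorProduct.AlgebraTensorModule.rid k K K)) x) := by
  induction x using TensorProduct.induction_on with
  | zero => simp only [map_zero]
  | add x y hx hy => simp only [map_add, hx, hy]
  | tmul a b =>
    have h (r : k) (x : K) : r • x = algebraMap k K r * x := Algebra.smul_def r x
    simp only [baseChangeD_tmul, map_add, LinearEquiv.trans_apply, LinearEquiv.baseChange_tmul,
      TensorProduct.AlgebraTensorModule.rid_tmul, hf, ofElemD_apply, h, Derivation.leibniz,
      deriv_algebraMap, map_mul]
    simp only [smul_eq_mul]
    ring

/-- The base change of `k e` with `∂ e = u e` is `K e` with `∂ e = u e`. -/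
noncomputable def baseChangeOfElem (u : k) :
    Iso ((ofElem u).baseChange K) (ofElem (algebraMap k K u)) where
  toEquiv := ((ofElemEquiv u).baseChange k K (ofElem u) k).trans
    (TensorProduct.AlgebraTensorModule.rid k K K)
  map_D := rid_baseChangeD (ofElemEquiv u) (fun _ => rfl)

variable [IsGalois k K]

theorem twist_leibniz (σ : Gal(K/k)) (A : DifferentialModule.{v, w} K) (x : K) (a : A) :
    A.D ((σ⁻¹ : Gal(K/k)) x • a) =
      (σ⁻¹ : Gal(K/k)) (x′) • a + (σ⁻¹ : Gal(K/k)) x • A.D a := by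
  rw [A.leibniz, Differential.algEquiv_deriv']

/-- The twist of `A` by `σ`: the same additive group and the same `∂`, with scalar multiplication
`x * a = (σ⁻¹ x) a`. -/
def twist (σ : Gal(K/k)) (A : DifferentialModule.{v, w} K) : DifferentialModule.{v, w} K where
  carrier := A.carrier
  module := Module.compHom A.carrier ((σ⁻¹ : Gal(K/k)) : K →+* K)
  D := A.D
  leibniz := twist_leibniz σ A

/-- Twisting is functorial for isomorphisms. -/
def Iso.twist (σ : Gal(K/k)) {A : DifferentialModule.{v, w₁} K} {B : DifferentialModule.{v, w₂} K}
    (f : Iso A B) : Iso (A.twist σ) (B.twist σ) where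
  toEquiv :=
    { toFun := fun a => f.toEquiv a
      invFun := fun b => f.toEquiv.symm b
      map_add' := fun a b => f.toEquiv.map_add a b
      map_smul' := fun x a => f.toEquiv.map_smul ((σ⁻¹ : Gal(K/k)) x) a
      left_inv := fun a => f.toEquiv.symm_apply_apply a
      right_inv := fun b => f.toEquiv.apply_symm_apply b }
  map_D := f.map_D

theorem twistOfElem_D (σ : Gal(K/k)) (u a : K) : σ (a′ + a * u) = (σ a)′ + σ a * σ u := by
  rw [map_add, map_mul, Differential.algEquiv_deriv']

/-- The twist of `K e` with `∂ e = u e` is `K e` with `∂ e = σ(u) e`. -/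
def twistOfElem (σ : Gal(K/k)) (u : K) : Iso ((ofElem u).twist σ) (ofElem (σ u)) where
  toEquiv :=
    { toFun := fun (a : K) => (σ a : K)
      invFun := fun (b : K) => (σ.symm b : K)
      map_add' := fun a b => map_add σ a b
      map_smul' := fun x a => twistOfElem_smul σ x a
      left_inv := fun a => σ.symm_apply_apply a
      right_inv := fun b => σ.apply_symm_apply b }
  map_D := twistOfElem_D σ u

variable (k K)

theorem twist_iso_iff {u : K} {A : DifferentialModule.{v, v} K} (f : Iso (ofElem u) A)
    (σ : Gal(K/k)) : Nonempty (Iso (A.twist σ) A) ↔ elemClass (σ u) = elemClass u := by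
  unfold elemClass
  rw [rankOneClass_eq_iff]
  constructor
  · rintro ⟨g⟩
    exact ⟨(twistOfElem σ u).symm.trans ((f.twist σ).trans (g.trans f.symm))⟩
  · rintro ⟨g⟩
    exact ⟨(f.symm.twist σ).trans ((twistOfElem σ u).trans (g.trans f))⟩

/-- The group `H(K)` of isomorphism classes of one-dimensional differential modules `A` over `K`
such that the twist of `A` by `σ` is isomorphic to `A` for all `σ ∈ Gal(K/k)`. -/
noncomputable def invariantClasses : Subgroup (RankOneClass K) where
  carrier := {x | ∃ (A : DifferentialModule.{v, v} K) (hA : Module.finrank K A = 1),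
    x = rankOneClass A hA ∧ ∀ σ : Gal(K/k), Nonempty (Iso (A.twist σ) A)}
  one_mem' := ⟨ofElem 0, finrank_ofElem 0, rfl, fun σ => by
    rw [twist_iso_iff k K (Iso.refl _), map_zero]⟩
  mul_mem' := by
    rintro _ _ ⟨A, hA, rfl, hA'⟩ ⟨B, hB, rfl, hB'⟩
    refine ⟨A.tensor B, finrank_tensor hA hB, rankOneClass_mul A B hA hB, fun σ => ?_⟩
    obtain ⟨u, ⟨f⟩⟩ := exists_iso_ofElem A hA
    obtain ⟨v, ⟨g⟩⟩ := exists_iso_ofElem B hB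
    have hu := (twist_iso_iff k K f σ).1 (hA' σ)
    have hv := (twist_iso_iff k K g σ).1 (hB' σ)
    rw [twist_iso_iff k K ((tensorOfElem u v).symm.trans (f.tensor g)), map_add,
      ← elemClass_mul, ← elemClass_mul, hu, hv]
  inv_mem' := by
    rintro _ ⟨A, hA, rfl, hA'⟩
    obtain ⟨u, ⟨f⟩⟩ := exists_iso_ofElem A hA
    refine ⟨ofElem (-u), finrank_ofElem _, ?_, fun σ => ?_⟩
    · change _ = elemClass (-u)
      rw [elemClass_neg]
      congr 1
      exact rankOneClass_eq_iff.2 ⟨f.symm⟩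
    · rw [twist_iso_iff k K (Iso.refl _), map_neg, elemClass_neg, elemClass_neg,
        (twist_iso_iff k K f σ).1 (hA' σ)]

/-- The group `h(K)` of isomorphism classes of one-dimensional differential modules over `K` of
the form `K ⊗ B`, with `B` a one-dimensional differential module over `k`. -/
noncomputable def descendedClasses : Subgroup (RankOneClass K) where
  carrier := {x | ∃ (A : DifferentialModule.{v, v} K) (hA : Module.finrank K A = 1),
    x = rankOneClass A hA ∧ ∃ B : DifferentialModule.{u, u} k,
      Module.finrank k B = 1 ∧ Nonempty (Iso A (B.baseChange K))}
  one_mem' := ⟨ofElem 0, finrank_ofElem 0, rfl, ofElem 0, finrank_ofElem 0,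
    ⟨(by rw [map_zero]; exact Iso.refl _ :
      Iso (ofElem (0 : K)) (ofElem (algebraMap k K 0))).trans (baseChangeOfElem 0).symm⟩⟩
  mul_mem' := by
    rintro _ _ ⟨A, hA, rfl, A', hA', ⟨f⟩⟩ ⟨B, hB, rfl, B', hB', ⟨g⟩⟩
    obtain ⟨u, ⟨f'⟩⟩ := exists_iso_ofElem A' hA'
    obtain ⟨v, ⟨g'⟩⟩ := exists_iso_ofElem B' hB'
    refine ⟨A.tensor B, finrank_tensor hA hB, rankOneClass_mul A B hA hB, ofElem (u + v),
      finrank_ofElem _, ⟨Iso.trans ?_ (baseChangeOfElem (u + v)).symm⟩⟩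
    rw [map_add]
    exact ((f.trans (f'.symm.baseChange.trans (baseChangeOfElem u))).tensor
      (g.trans (g'.symm.baseChange.trans (baseChangeOfElem v)))).trans (tensorOfElem _ _)
  inv_mem' := by
    rintro _ ⟨A, hA, rfl, A', hA', ⟨f⟩⟩
    obtain ⟨u, ⟨f'⟩⟩ := exists_iso_ofElem A' hA'
    refine ⟨ofElem (algebraMap k K (-u)), finrank_ofElem _, ?_, ofElem (-u), finrank_ofElem _,
      ⟨(baseChangeOfElem (-u)).symm⟩⟩
    change _ = elemClass _
    rw [map_neg, elemClass_neg]
    congr 1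
    exact rankOneClass_eq_iff.2 ⟨f.trans (f'.symm.baseChange.trans (baseChangeOfElem u))⟩

variable {k K}

/-- `c` is an obstruction cocycle of `A`: there are `σ`-linear bijections `Φ σ : A → A` commuting
with `∂` (that is, isomorphisms from the twist of `A` by `σ` to `A`), such that `σ ↦ Φ σ a` is
locally constant for all `a`, and `Φ (σ τ) = c (σ, τ) Φ σ Φ τ`. -/
def IsObstructionCocycle (A : DifferentialModule.{v, w} K)
    (c : Gal(K/k) × Gal(K/k) → (constantField k)ˣ) : Prop :=
  ∃ Φ : Gal(K/k) → A ≃+ A,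
    (∀ (σ : Gal(K/k)) (x : K) (a : A), Φ σ (x • a) = σ x • Φ σ a) ∧
    (∀ (σ : Gal(K/k)) (a : A), Φ σ (A.D a) = A.D (Φ σ a)) ∧
    (∀ a : A, IsLocallyConstant fun σ => Φ σ a) ∧
    ∀ (σ τ : Gal(K/k)) (a : A),
      Φ (σ * τ) a = algebraMap k K (c (σ, τ) : constantField k) • Φ σ (Φ τ a)

end Descent

end DifferentialModule

/-! Continuous cohomology in degree two of a topological group `G` with coefficients in an abelian
group `M`, written multiplicatively, with the discrete topology and the trivial action of `G`,
through inhomogeneous cochains. A cochain is continuous if and only if it is locally constant. -/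

section Cohomology

variable (G : Type u) (M : Type v) [Group G] [TopologicalSpace G] [CommGroup M]

/-- Continuous `2`-cocycles. -/
def contTwoCocycles : Subgroup (G × G → M) where
  carrier := {c | IsLocallyConstant c ∧
    ∀ g h j : G, c (g * h, j) * c (g, h) = c (h, j) * c (g, h * j)}
  one_mem' := ⟨IsLocallyConstant.const 1, fun _ _ _ => rfl⟩
  mul_mem' := by
    rintro a b ⟨ha, ha'⟩ ⟨hb, hb'⟩
    refine ⟨ha.mul hb, fun g h j => ?_⟩
    simp only [Pi.mul_apply]
    rw [mul_mul_mul_comm, ha', hb', mul_mul_mul_comm]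
  inv_mem' := by
    rintro a ⟨ha, ha'⟩
    refine ⟨ha.inv, fun g h j => ?_⟩
    simp only [Pi.inv_apply]
    rw [← mul_inv, ha', mul_inv]

/-- Coboundaries `(g, h) ↦ x(h) x(gh)⁻¹ x(g)` of continuous `1`-cochains `x`. -/
def contTwoCoboundaries : Subgroup (G × G → M) where
  carrier := {c | ∃ x : G → M, IsLocallyConstant x ∧ ∀ g h : G, x h / x (g * h) * x g = c (g, h)}
  one_mem' := ⟨1, IsLocallyConstant.const 1, fun _ _ => by simp⟩
  mul_mem' := by
    rintro a b ⟨x, hx, hx'⟩ ⟨y, hy, hy'⟩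
    refine ⟨x * y, hx.mul hy, fun g h => ?_⟩
    simp only [Pi.mul_apply]
    rw [← hx', ← hy', mul_div_mul_comm, mul_mul_mul_comm]
  inv_mem' := by
    rintro a ⟨x, hx, hx'⟩
    refine ⟨x⁻¹, hx.inv, fun g h => ?_⟩
    simp only [Pi.inv_apply]
    rw [← hx', mul_inv, inv_div_inv, inv_div]

/-- `H²(G, M)`: continuous `2`-cocycles modulo coboundaries. -/
abbrev ContH2 : Type (max u v) :=
  contTwoCocycles G M ⧸ (contTwoCoboundaries G M).subgroupOf (contTwoCocycles G M)

end Cohomology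

/-! Write `A = K e` with `∂ e = u e`. By `elemClass_eq_iff`, replacing `e` changes `u` by a
logarithmic derivative, so the class of `A` is that of `u` modulo `dlog K*`. Invariance means `σ u -
u = dlog f(σ)` for some `f(σ)` in `K*`. The defect `c(σ, τ) = f(στ) / (f(σ) σ(f(τ)))` then has
logarithmic derivative zero, so it is a constant of `K`; as `C` is algebraically closed, `K` has no
constants outside `C` (`exists_constantField_of_deriv_eq_zero`). Thus `c` is a 2-cocycle in `C*`,
and since `f` is unique up to `C*`-valued cochains, its class depends only on the class of `A`.

Kernel: if `c` is a coboundary, scaling `f` by constants makes it a genuine cocycle, Hilbert 90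
gives `f(σ) = σ g / g` after scaling, and `u - dlog g` is Galois invariant, hence in `k`.

Surjectivity is where the `C₁` property and characteristic zero enter. A cocycle `c` comes from a
finite Galois extension `L` of `k` and becomes a coboundary of some `f` in `L*`. As `c` is constant,
`dlog f` is an additive cocycle, and additive Hilbert 90 gives `u`.

To trivialize `c` over `L`, take a projective semilinear representation with factor set `c` of least
positive dimension `n`. Its commutant spans all `n × n` matrices over `L`, and the determinant on it
(a reduced norm) is a form over `k` of degree `n` in `n²` variables. If `n > 1`, a nontrivial zero
is a singular nonzero intertwiner, whose kernel is a smaller representation. So `n = 1`, and the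
representation is the desired `f`. -/

/-! ### Projective semilinear representations and triviality of 2-cocycles over `C₁`-fields. -/

section SemilinearDescent

variable {k : Type u} {L : Type v} [Field k] [Field L] [Algebra k L]

/-- Galois descent: a vector space over a finite Galois extension with a semilinear action of the
Galois group is spanned by the invariant vectors. -/
theorem span_invariants_eq_top [FiniteDimensional k L] {E : Type w} [AddCommGroup E] [Module L E]
    (ρ : Gal(L/k) → E →+ E) (hsmul : ∀ σ (x : L) e, ρ σ (x • e) = σ x • ρ σ e)
    (hone : ∀ e, ρ 1 e = e) (hmul : ∀ σ τ e, ρ (σ * τ) e = ρ σ (ρ τ e)) :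
    Submodule.span L {e | ∀ σ, ρ σ e = e} = ⊤ := by
  classical
  by_contra hne
  -- A functional `φ` vanishing on the invariants kills every trace `∑ ρ σ (x • e)`. This is a
  -- linear relation between the automorphisms `σ`, with coefficients `φ (ρ σ e)`; by Dedekind
  -- independence they vanish, in particular at `σ = 1`.
  obtain ⟨φ, hφ, hle⟩ := Submodule.exists_le_ker_of_lt_top _ (lt_top_iff_ne_top.2 hne)
  refine hφ (LinearMap.ext fun e => ?_)
  have hli : LinearIndependent L (fun σ : Gal(L/k) => (σ : L → L)) :=
    (linearIndependent_monoidHom L L).comp (fun σ : Gal(L/k) => ((σ : L →* L)))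
      (fun σ τ h => by ext x; exact DFunLike.congr_fun h x)
  have hzero : ∑ σ : Gal(L/k), φ (ρ σ e) • (σ : L → L) = 0 := by
    funext x
    have hinv : (∑ σ : Gal(L/k), ρ σ (x • e)) ∈ Submodule.span L {e | ∀ σ, ρ σ e = e} := by
      refine Submodule.subset_span fun τ => ?_
      rw [map_sum]
      simp only [← hmul]
      exact Fintype.sum_equiv (Equiv.mulLeft τ) _ _ fun _ => rfl
    have h := hle hinv
    rw [LinearMap.mem_ker, map_sum] at h
    simp only [Finset.sum_apply, Pi.smul_apply, smul_eq_mul, Pi.zero_apply]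
    rw [← h]
    exact Finset.sum_congr rfl fun σ _ => by rw [hsmul, map_smul, smul_eq_mul, mul_comm]
  have h := Fintype.linearIndependent_iff.1 hli _ hzero 1
  rwa [hone] at h

/-- A projective semilinear representation with factor set `c`, by injective maps. -/
structure IsProjectiveSemilinear (c : Gal(L/k) → Gal(L/k) → k) {V : Type w} [AddCommGroup V]
    [Module L V] (U : Gal(L/k) → V →+ V) : Prop where
  injective : ∀ σ, Function.Injective (U σ)
  map_smul : ∀ σ (x : L) v, U σ (x • v) = σ x • U σ v
  map_mul : ∀ σ τ v, U (σ * τ) v = algebraMap k L (c σ τ) • U σ (U τ v)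

/-- There is a projective semilinear representation of dimension `n` with factor set `c`. -/
def HasProjectiveSemilinear (L : Type v) [Field L] [Algebra k L] (c : Gal(L/k) → Gal(L/k) → k)
    (n : ℕ) : Prop :=
  ∃ U : Gal(L/k) → (Fin n → L) →+ (Fin n → L), IsProjectiveSemilinear c U

namespace IsProjectiveSemilinear

variable {c : Gal(L/k) → Gal(L/k) → k} {V : Type w} [AddCommGroup V] [Module L V]
  {U : Gal(L/k) → V →+ V}

/-- `U 1` need not be the identity; the relation at `(1, 1)` and injectivity force it to be a
scalar. -/
theorem map_one (hU : IsProjectiveSemilinear c U) (v : V) :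
    v = algebraMap k L (c 1 1) • U 1 v := by
  apply hU.injective 1
  have h := hU.map_mul 1 1 v
  rw [hU.map_smul, AlgEquiv.commutes, ← h, mul_one]

/-- Expanding `U (σ σ⁻¹)` exhibits a preimage under `U σ`, so surjectivity need not be part of the
structure. -/
theorem eq_map_smul (hU : IsProjectiveSemilinear c U) (σ : Gal(L/k)) (v : V) :
    v = U σ (algebraMap k L (c 1 1 * c σ σ⁻¹) • U σ⁻¹ v) := by
  conv_lhs => rw [hU.map_one v, ← mul_inv_cancel σ, hU.map_mul]
  rw [hU.map_smul, AlgEquiv.commutes, smul_smul, _root_.map_mul]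
  simp

theorem surjective (hU : IsProjectiveSemilinear c U) (σ : Gal(L/k)) :
    Function.Surjective (U σ) := fun v => ⟨_, (hU.eq_map_smul σ v).symm⟩

theorem hasProjectiveSemilinear (hU : IsProjectiveSemilinear c U) [FiniteDimensional L V] :
    HasProjectiveSemilinear L c (Module.finrank L V) := by
  let e : V ≃ₗ[L] (Fin (Module.finrank L V) → L) := (Module.finBasis L V).equivFun
  refine ⟨fun σ => (e.toLinearMap.toAddMonoidHom.comp (U σ)).comp
    e.symm.toLinearMap.toAddMonoidHom, ⟨fun σ => ?_, fun σ x v => ?_, fun σ τ v => ?_⟩⟩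
  · exact e.injective.comp ((hU.injective σ).comp e.symm.injective)
  · change e (U σ (e.symm (x • v))) = σ x • e (U σ (e.symm v))
    rw [_root_.map_smul, hU.map_smul, _root_.map_smul]
  · change e (U (σ * τ) (e.symm v)) = _ • e (U σ (e.symm (e (U τ (e.symm v)))))
    rw [hU.map_mul, _root_.map_smul, e.symm_apply_apply]

/-- The restriction of a projective semilinear representation to a stable subspace. -/
theorem restrict (hU : IsProjectiveSemilinear c U) (W : Submodule L V)
    (hW : ∀ σ, ∀ v ∈ W, U σ v ∈ W) :
    ∃ U' : Gal(L/k) → W →+ W, IsProjectiveSemilinear c U' := by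
  refine ⟨fun σ => AddMonoidHom.mk' (fun v => ⟨U σ v, hW σ v v.2⟩)
    (fun v w => Subtype.ext (_root_.map_add (U σ) (v : V) w)), ⟨fun σ v w h => ?_, fun σ x v => ?_,
    fun σ τ v => ?_⟩⟩
  · exact Subtype.ext (hU.injective σ (congrArg Subtype.val h))
  · exact Subtype.ext (hU.map_smul σ x v)
  · exact Subtype.ext (hU.map_mul σ τ v)

/-- The linear endomorphisms commuting with a projective semilinear representation span the space
of all endomorphisms. -/
theorem span_commutant [FiniteDimensional k L] (hU : IsProjectiveSemilinear c U)
    (hc : ∀ σ τ, c σ τ ≠ 0) :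
    Submodule.span L {f : V →ₗ[L] V | ∀ σ v, f (U σ v) = U σ (f v)} = ⊤ := by
  let e (σ : Gal(L/k)) : V ≃+ V := AddEquiv.ofBijective (U σ) ⟨hU.injective σ, hU.surjective σ⟩
  have he (σ : Gal(L/k)) (v : V) : e σ v = U σ v := rfl
  have hsymm (σ : Gal(L/k)) (x : L) (v : V) : (e σ).symm (σ x • v) = x • (e σ).symm v := by
    rw [AddEquiv.symm_apply_eq, he, hU.map_smul, ← he, AddEquiv.apply_symm_apply]
  -- Conjugation by `U σ`. The factor set cancels, so this is a genuine semilinear action on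
  -- endomorphisms, whose invariants are the commutant; Galois descent applies.
  let ρ (σ : Gal(L/k)) : (V →ₗ[L] V) →+ (V →ₗ[L] V) := AddMonoidHom.mk'
    (fun f =>
      { toFun := fun v => U σ (f ((e σ).symm v))
        map_add' := fun v w => by simp only [_root_.map_add]
        map_smul' := fun x v => by
          have h := hsymm σ (σ.symm x) v
          rw [AlgEquiv.apply_symm_apply] at h
          rw [h, _root_.map_smul, hU.map_smul, AlgEquiv.apply_symm_apply, RingHom.id_apply] })
    (fun f g => by ext v; simp)
  have hρ (σ : Gal(L/k)) (f : V →ₗ[L] V) (v : V) : ρ σ f (U σ v) = U σ (f v) := by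
    change U σ (f ((e σ).symm (e σ v))) = _
    rw [AddEquiv.symm_apply_apply]
  have hext (σ : Gal(L/k)) (f g : V →ₗ[L] V) (h : ∀ v, f (U σ v) = g (U σ v)) : f = g :=
    LinearMap.ext fun v => by
      obtain ⟨w, rfl⟩ := hU.surjective σ v
      exact h w
  have key := span_invariants_eq_top ρ
    (fun σ x f => hext σ _ _ fun v => by
      rw [hρ, LinearMap.smul_apply, LinearMap.smul_apply, hρ, hU.map_smul])
    (fun f => hext 1 _ _ fun v => by
      rw [hρ]
      have hne : algebraMap k L (c 1 1) ≠ 0 := (_root_.map_ne_zero _).2 (hc 1 1)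
      apply smul_right_injective V hne
      simp only
      rw [← hU.map_one, ← _root_.map_smul, ← hU.map_one])
    (fun σ τ f => hext (σ * τ) _ _ fun v => by
      rw [hρ, hU.map_mul, hU.map_mul, _root_.map_smul, hρ, hρ])
  rw [← key]
  congr 1
  ext f
  refine forall_congr' fun σ => ⟨fun h => hext σ _ _ fun v => ?_, fun h v => ?_⟩
  · rw [hρ, h]
  · rw [← hρ, h]

end IsProjectiveSemilinear

/-- The crossed product representation attached to a `2`-cocycle. -/
theorem hasProjectiveSemilinear_card [FiniteDimensional k L] (c : Gal(L/k) → Gal(L/k) → k)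
    (hc : ∀ σ τ, c σ τ ≠ 0)
    (hcocycle : ∀ σ τ ρ, c (σ * τ) ρ * c σ τ = c τ ρ * c σ (τ * ρ)) :
    ∃ n, 0 < n ∧ HasProjectiveSemilinear L c n := by
  -- On the standard basis, `U σ (a e_τ) = c(σ, τ)⁻¹ σ(a) e_{στ}`. The inverse matches the
  -- convention that puts `c` on the side of `U σ U τ`.
  let U (σ : Gal(L/k)) : (Gal(L/k) → L) →+ (Gal(L/k) → L) := AddMonoidHom.mk'
    (fun v x => (algebraMap k L (c σ (σ⁻¹ * x)))⁻¹ * σ (v (σ⁻¹ * x)))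
    (fun v w => by funext x; simp [mul_add])
  have hne (σ τ : Gal(L/k)) : algebraMap k L (c σ τ) ≠ 0 := (map_ne_zero _).2 (hc σ τ)
  have hU : IsProjectiveSemilinear c U := by
    refine ⟨fun σ v w h => funext fun x => ?_, fun σ x v => funext fun y => ?_,
      fun σ τ v => funext fun x => ?_⟩
    · have hx := congrFun h (σ * x)
      simpa [U, hne] using hx
    · simp only [U, AddMonoidHom.mk'_apply, Pi.smul_apply, smul_eq_mul, map_mul]
      ring
    · have h := congrArg (algebraMap k L) (hcocycle σ τ (τ⁻¹ * (σ⁻¹ * x)))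
      rw [map_mul, map_mul, mul_inv_cancel_left] at h
      simp only [U, AddMonoidHom.mk'_apply, Pi.smul_apply, smul_eq_mul, map_mul, map_inv₀,
        AlgEquiv.commutes, mul_inv_rev, AlgEquiv.mul_apply, mul_assoc]
      have h1 := hne (σ * τ) (τ⁻¹ * (σ⁻¹ * x))
      have h2 := hne σ (σ⁻¹ * x)
      have h3 := hne τ (τ⁻¹ * (σ⁻¹ * x))
      field_simp
      linear_combination (-(σ (τ (v (τ⁻¹ * (σ⁻¹ * x)))))) * h
  exact ⟨_, Module.finrank_pos, hU.hasProjectiveSemilinear⟩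

open MvPolynomial in
theorem MvPolynomial.isHomogeneous_det {R : Type*} [CommRing R] {ι : Type*} {n d : ℕ}
    (Q : Matrix (Fin n) (Fin n) (MvPolynomial ι R)) (hQ : ∀ i j, (Q i j).IsHomogeneous d) :
    Q.det.IsHomogeneous (n * d) := by
  rw [Matrix.det_apply]
  refine IsHomogeneous.sum _ _ _ fun σ _ => ?_
  have h : (∏ i, Q (σ i) i).IsHomogeneous (n * d) := by
    have h' := IsHomogeneous.prod Finset.univ (fun i => Q (σ i) i) (fun _ => d) fun i _ => hQ _ _
    simpa using h'
  rcases Int.units_eq_one_or (Equiv.Perm.sign σ) with hs | hs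
  · rw [hs, one_smul]; exact h
  · rw [hs, Units.neg_smul, one_smul]; exact h.neg

open MvPolynomial in
/-- Over a `C₁`-field, a projective semilinear representation of dimension at least two has a
representation of smaller positive dimension with the same factor set. -/
theorem HasProjectiveSemilinear.exists_lt [FiniteDimensional k L] [IsGalois k L]
    (hk : IsC1Field k) {c : Gal(L/k) → Gal(L/k) → k} (hc : ∀ σ τ, c σ τ ≠ 0) {n : ℕ}
    (hn : 1 < n) (h : HasProjectiveSemilinear L c n) :
    ∃ m, 0 < m ∧ m < n ∧ HasProjectiveSemilinear L c m := by
  obtain ⟨U, hU⟩ := h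
  -- An `L`-basis of all endomorphisms chosen inside the commutant, hence of `n²` elements.
  obtain ⟨N, hN, M, hM, hli⟩ : ∃ N : ℕ, N = n * n ∧ ∃ M : Fin N → (Fin n → L) →ₗ[L] (Fin n → L),
      (∀ l σ v, M l (U σ v) = U σ (M l v)) ∧ LinearIndependent L M := by
    obtain ⟨M, hM, -, hli⟩ := Submodule.exists_fun_fin_finrank_span_eq L
      {f : (Fin n → L) →ₗ[L] (Fin n → L) | ∀ σ v, f (U σ v) = U σ (f v)}
    refine ⟨_, ?_, M, hM, hli⟩
    rw [hU.span_commutant hc, finrank_top, Module.finrank_linearMap, Module.finrank_fin_fun]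
  -- The generic element `∑ X_l M_l` of the commutant.
  let Q : Matrix (Fin n) (Fin n) (MvPolynomial (Fin N) L) :=
    ∑ i, (X i : MvPolynomial (Fin N) L) • (LinearMap.toMatrix' (M i)).map C
  have hQ (i j) : Q i j = ∑ l, X l * C (M l (Pi.single j 1) i) := by
    simp [Q, Matrix.sum_apply, LinearMap.toMatrix'_apply]
  have hhom : Q.det.IsHomogeneous n := by
    have h1 : ∀ i j, (Q i j).IsHomogeneous 1 := fun i j => ?_
    · simpa using isHomogeneous_det Q h1
    rw [hQ]
    refine IsHomogeneous.sum _ _ _ fun l _ => ?_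
    rw [mul_comm]
    exact (isHomogeneous_X L l).C_mul _
  -- If `A` is the matrix of `U σ`, commutation with `U σ` reads `M_l A = A σ(M_l)`. Hence `Q A = A
  -- σ(Q)`, and cancelling `det A` shows that `det Q` has Galois-invariant coefficients.
  have hinv (σ : Gal(L/k)) : map (σ : L →+* L) Q.det = Q.det := by
    let A : Matrix (Fin n) (Fin n) L := Matrix.of fun i j => U σ (Pi.single j 1) i
    have hA (v : Fin n → L) : U σ v = A.mulVec fun i => σ (v i) := by
      conv_lhs => rw [← Finset.univ_sum_single v]
      funext i
      have h1 (j : Fin n) : Pi.single j (v j) = v j • (Pi.single j 1 : Fin n → L) := by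
        rw [← Pi.single_smul]; simp
      simp only [h1, map_sum, hU.map_smul, Finset.sum_apply, Pi.smul_apply, smul_eq_mul,
        Matrix.mulVec, dotProduct, A, Matrix.of_apply]
      exact Finset.sum_congr rfl fun _ _ => mul_comm _ _
    have hdet : A.det ≠ 0 := by
      rw [Ne, ← Matrix.exists_mulVec_eq_zero_iff]
      rintro ⟨w, hw, hw0⟩
      apply hw
      have h0 : U σ (fun i => σ.symm (w i)) = U σ 0 := by
        rw [hA, map_zero, ← hw0]
        congr 1
        funext i
        exact σ.apply_symm_apply _
      funext i
      have hi := congrFun (hU.injective σ h0) i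
      simpa using hi
    have hcomm (l : Fin N) : LinearMap.toMatrix' (M l) * A =
        A * (LinearMap.toMatrix' (M l)).map σ := by
      ext i j
      have hl := congrFun (hM l σ (Pi.single j 1)) i
      rw [hA (M l _)] at hl
      rw [Matrix.mul_apply, Matrix.mul_apply]
      have hcol := congrFun (LinearMap.toMatrix'_mulVec (M l) (U σ (Pi.single j 1))) i
      rw [hl] at hcol
      simpa [Matrix.mulVec, dotProduct, LinearMap.toMatrix'_apply, A] using hcol
    have hQA : Q * A.map C = A.map C * Q.map (map (σ : L →+* L)) := by
      have h1 : Q.map (map (σ : L →+* L)) =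
          ∑ l, (X l : MvPolynomial (Fin N) L) •
            ((LinearMap.toMatrix' (M l)).map σ).map C := by
        ext1 i j
        simp [hQ, Matrix.sum_apply, LinearMap.toMatrix'_apply]
      rw [h1, Matrix.mul_sum, Matrix.sum_mul]
      refine Finset.sum_congr rfl fun l _ => ?_
      rw [Matrix.smul_mul, Matrix.mul_smul, ← Matrix.map_mul, ← Matrix.map_mul, hcomm]
    have hd := congrArg Matrix.det hQA
    rw [Matrix.det_mul, Matrix.det_mul, mul_comm Q.det] at hd
    have hC : (A.map (C : L →+* MvPolynomial (Fin N) L)).det = C A.det :=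
      (RingHom.map_det C A).symm
    rw [hC] at hd
    have h2 := mul_left_cancel₀ (by simpa using hdet) hd
    rw [RingHom.map_det]
    exact h2.symm
  obtain ⟨p, hp⟩ : ∃ p : MvPolynomial (Fin N) k, map (algebraMap k L) p = Q.det := by
    apply mem_range_map_iff_coeffs_subset.2
    intro a ha
    obtain ⟨s, -, rfl⟩ := mem_coeffs_iff.1 ha
    rw [IsGalois.mem_range_algebraMap_iff_fixed]
    intro σ
    conv_rhs => rw [← hinv σ, coeff_map]
    rfl
  have hphom : p.IsHomogeneous n :=
    IsHomogeneous.of_map (algebraMap k L).injective (by rwa [hp])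
  obtain ⟨x, hx, hx0⟩ := hk N n p hphom hn.le (by nlinarith)
  -- The coefficients lie in `k`, so `d` commutes with every `U σ`. It is nonzero by independence of
  -- the `M_l` and singular by the choice of `x`, so its kernel is stable, nonzero and proper.
  let d : (Fin n → L) →ₗ[L] (Fin n → L) := ∑ l, algebraMap k L (x l) • M l
  have hd0 : d ≠ 0 := fun h0 => hx <| funext fun l => by
    simpa using Fintype.linearIndependent_iff.1 hli _ h0 l
  have hdet : (LinearMap.toMatrix' d).det = 0 := by
    have h1 := congrArg (eval fun l => algebraMap k L (x l)) hp
    rw [eval_map, ← Function.comp_def (algebraMap k L), ← eval₂_comp, hx0, map_zero,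
      RingHom.map_det] at h1
    rw [h1]
    congr 1
    ext i j
    simp [d, hQ, LinearMap.toMatrix'_apply, Algebra.smul_def]
  obtain ⟨v, hv, hv0⟩ := Matrix.exists_mulVec_eq_zero_iff.2 hdet
  rw [LinearMap.toMatrix'_mulVec] at hv0
  have hstable (σ : Gal(L/k)) (w : Fin n → L) (hw : w ∈ LinearMap.ker d) :
      U σ w ∈ LinearMap.ker d := by
    have hcomm : d (U σ w) = U σ (d w) := by
      simp [d, hM, hU.map_smul, -algebraMap_smul]
    rw [LinearMap.mem_ker, hcomm, LinearMap.mem_ker.1 hw, map_zero]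
  obtain ⟨U', hU'⟩ := hU.restrict _ hstable
  refine ⟨_, ?_, ?_, hU'.hasProjectiveSemilinear⟩
  · have : Nontrivial (LinearMap.ker d) :=
      ⟨⟨v, hv0⟩, 0, fun h => hv (congrArg Subtype.val h)⟩
    exact Module.finrank_pos
  · have hlt : LinearMap.ker d < ⊤ := lt_top_iff_ne_top.2 fun h => hd0 (LinearMap.ker_eq_top.1 h)
    simpa using Submodule.finrank_lt hlt.ne

/-- Over a `C₁`-field `k`, every `2`-cocycle of a finite Galois group with values in `kˣ` becomes
a coboundary in `Lˣ`. -/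
theorem exists_trivialization_of_isC1Field [FiniteDimensional k L] [IsGalois k L]
    (hk : IsC1Field k) (c : Gal(L/k) → Gal(L/k) → k) (hc : ∀ σ τ, c σ τ ≠ 0)
    (hcocycle : ∀ σ τ ρ, c (σ * τ) ρ * c σ τ = c τ ρ * c σ (τ * ρ)) :
    ∃ f : Gal(L/k) → L, (∀ σ, f σ ≠ 0) ∧
      ∀ σ τ, f (σ * τ) = algebraMap k L (c σ τ) * (f σ * σ (f τ)) := by
  classical
  have hex := hasProjectiveSemilinear_card c hc hcocycle
  obtain ⟨hpos, hn⟩ := Nat.find_spec hex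
  have hone : Nat.find hex = 1 := by
    by_contra hne
    obtain ⟨m, hm, hlt, hm'⟩ := hn.exists_lt hk hc (by omega)
    exact Nat.find_min hex hlt ⟨hm, hm'⟩
  rw [hone] at hn
  obtain ⟨U, hU⟩ := hn
  -- In dimension one `U σ` is determined by the scalar `U σ 1 0`, which serves as `f σ`.
  have hv (v : Fin 1 → L) : v = v 0 • (1 : Fin 1 → L) := by
    funext i; rw [Subsingleton.elim i 0]; simp
  refine ⟨fun σ => U σ 1 0, fun σ h0 => ?_, fun σ τ => ?_⟩
  · have h1 : U σ 1 = U σ 0 := by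
      simp only at h0
      rw [hv (U σ 1), h0, zero_smul, map_zero]
    exact one_ne_zero (hU.injective σ h1)
  · simp only
    rw [hU.map_mul, hv (U τ 1), hU.map_smul]
    simp [mul_comm]

end SemilinearDescent

/-! ### Continuous cochains of the Galois group and Hilbert 90. -/

section ContinuousCochains

open Topology

/-- A locally constant function on a compact group is invariant under translation by a
neighbourhood of the identity. -/
theorem IsLocallyConstant.eventually_mul_right_eq {G X : Type*} [Group G] [TopologicalSpace G]
    [ContinuousMul G] [CompactSpace G] {f : G → X} (hf : IsLocallyConstant f) :
    ∀ᶠ g in 𝓝 (1 : G), ∀ x, f (x * g) = f x := by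
  -- Compactness makes the pointwise neighbourhoods uniform in `x`, as in the tube lemma.
  have h := isCompact_univ.eventually_forall_of_forall_eventually (x₀ := (1 : G))
    (P := fun g x => f (x * g) = f x) (K := (Set.univ : Set G)) ?_
  · simpa using h
  · intro y _
    have hcont : Continuous fun z : G × G => z.2 * z.1 := by fun_prop
    have h1 := (hf.comp_continuous hcont).eventually_eq (1, y)
    have h2 := (hf.comp_continuous continuous_snd).eventually_eq ((1 : G), y)
    filter_upwards [h1, h2] with z hz1 hz2
    simp only [Function.comp_apply, mul_one] at hz1 hz2
    rw [hz1, hz2]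

variable {k : Type u} {K : Type v} [Field k] [Field K] [Algebra k K]

theorem restrictNormalHom_eq_iff [Normal k K] (L : IntermediateField k K) [Normal k L]
    {σ τ : Gal(K/k)} :
    AlgEquiv.restrictNormalHom L σ = AlgEquiv.restrictNormalHom L τ ↔
      τ⁻¹ * σ ∈ L.fixingSubgroup := by
  rw [← IntermediateField.restrictNormalHom_ker, MonoidHom.mem_ker, map_mul, map_inv,
    inv_mul_eq_one, eq_comm]

theorem isLocallyConstant_comp_restrictNormalHom [Normal k K] {X : Type*}
    (L : IntermediateField k K) [FiniteDimensional k L] [Normal k L] (f : Gal(L/k) → X) :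
    IsLocallyConstant fun σ : Gal(K/k) => f (AlgEquiv.restrictNormalHom L σ) :=
  (IsLocallyConstant.of_discrete f).comp_continuous (InfiniteGalois.restrictNormalHom_continuous L)

variable [IsGalois k K]

/-- A locally constant function on the Galois group factors through a finite Galois group. -/
theorem IsLocallyConstant.exists_finite_normal {X : Type*} {f : Gal(K/k) → X}
    (hf : IsLocallyConstant f) :
    ∃ L : IntermediateField k K, ∃ _ : FiniteDimensional k L, ∃ _ : Normal k L,
      ∀ σ τ, AlgEquiv.restrictNormalHom L σ = AlgEquiv.restrictNormalHom L τ → f σ = f τ := by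
  obtain ⟨L, hfin, hnor, hL⟩ :=
    (krullTopology_mem_nhds_one_iff_of_normal k K _).1 hf.eventually_mul_right_eq
  refine ⟨L, hfin, hnor, fun σ τ h => ?_⟩
  have h1 := hL ((restrictNormalHom_eq_iff L).1 h) τ
  rwa [mul_inv_cancel_left] at h1

/-- A locally constant function of two variables in the Galois group factors through a finite
Galois group. -/
theorem IsLocallyConstant.exists_finite_normal_prod {X : Type*} {f : Gal(K/k) × Gal(K/k) → X}
    (hf : IsLocallyConstant f) :
    ∃ L : IntermediateField k K, ∃ _ : FiniteDimensional k L, ∃ _ : Normal k L,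
      ∀ σ τ σ' τ', AlgEquiv.restrictNormalHom L σ = AlgEquiv.restrictNormalHom L σ' →
        AlgEquiv.restrictNormalHom L τ = AlgEquiv.restrictNormalHom L τ' →
        f (σ, τ) = f (σ', τ') := by
  have h := hf.eventually_mul_right_eq
  rw [← Prod.mk_one_one, nhds_prod_eq] at h
  obtain ⟨t, ht, h⟩ := Filter.eventually_prod_self_iff'.1 h
  obtain ⟨L, hfin, hnor, hL⟩ := (krullTopology_mem_nhds_one_iff_of_normal k K _).1 ht
  refine ⟨L, hfin, hnor, fun σ τ σ' τ' hσ hτ => ?_⟩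
  have h1 := h _ (hL ((restrictNormalHom_eq_iff L).1 hσ)) _
    (hL ((restrictNormalHom_eq_iff L).1 hτ)) (σ', τ')
  rwa [Prod.mk_mul_mk, mul_inv_cancel_left, mul_inv_cancel_left] at h1

/-- The stabilizer of `x` is open since `x` is algebraic, and the map is constant on its left
cosets. -/
theorem isLocallyConstant_apply (x : K) : IsLocallyConstant fun σ : Gal(K/k) => σ x := by
  rw [IsLocallyConstant.iff_eventually_eq]
  intro σ
  have hopen := stabilizer_isOpen_of_isIntegral (K := k) x
  have h1 : ∀ᶠ τ in 𝓝 (1 : Gal(K/k)), τ x = x :=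
    hopen.mem_nhds (one_mem (MulAction.stabilizer Gal(K/k) x))
  have h2 : Filter.Tendsto (fun τ => σ⁻¹ * τ) (𝓝 σ) (𝓝 (1 : Gal(K/k))) := by
    have : Continuous fun τ : Gal(K/k) => σ⁻¹ * τ := by fun_prop
    simpa using this.tendsto σ
  filter_upwards [h2.eventually h1] with τ hτ
  have h3 := congrArg σ hτ
  rwa [← AlgEquiv.mul_apply, mul_inv_cancel_left] at h3

theorem isLocallyConstant_apply_apply {f : Gal(K/k) → K} (hf : IsLocallyConstant f) :
    IsLocallyConstant fun p : Gal(K/k) × Gal(K/k) => p.1 (f p.2) := by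
  rw [IsLocallyConstant.iff_eventually_eq]
  rintro ⟨σ, τ⟩
  have h1 := ((isLocallyConstant_apply (k := k) (f τ)).comp_continuous
    (continuous_fst (Y := Gal(K/k)))).eventually_eq (σ, τ)
  have h2 := (hf.comp_continuous (continuous_snd (X := Gal(K/k)))).eventually_eq (σ, τ)
  filter_upwards [h1, h2] with p hp1 hp2
  simp only [Function.comp_apply] at hp1 hp2
  rw [hp2, hp1]

/-- Additive Hilbert 90 for continuous cocycles of a Galois group in characteristic zero. -/
theorem exists_eq_sub_of_isLocallyConstant [CharZero k] {a : Gal(K/k) → K}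
    (ha : IsLocallyConstant a) (hmul : ∀ σ τ, a (σ * τ) = a σ + σ (a τ)) :
    ∃ u, ∀ σ, a σ = σ u - u := by
  obtain ⟨L, hfin, hnor, hL⟩ := ha.exists_finite_normal
  -- The lifts `s` need not be multiplicative; only their restrictions to `L` matter, because `a`
  -- factors through `Gal(L/k)`.
  choose s hs using AlgEquiv.restrictNormalHom_surjective (F := k) (K₁ := L) K
  have : CharZero K := charZero_of_injective_algebraMap (algebraMap k K).injective
  set n : K := Nat.cast (Fintype.card Gal(L/k)) with hndef
  have hn : n ≠ 0 := Nat.cast_ne_zero.2 Fintype.card_ne_zero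
  -- Minus the average of the cocycle over the finite quotient; characteristic zero permits division
  -- by its order.
  refine ⟨-(n⁻¹ * ∑ x, a (s x)), fun σ => ?_⟩
  have h1 : σ (∑ x, a (s x)) = ∑ x, a (s x) - n * a σ := by
    have h2 (x : Gal(L/k)) : σ (a (s x)) =
        a (s (AlgEquiv.restrictNormalHom L σ * x)) - a σ := by
      rw [hL (s (AlgEquiv.restrictNormalHom L σ * x)) (σ * s x) (by simp [hs]), hmul]
      ring
    rw [map_sum, Finset.sum_congr rfl fun x _ => h2 x, Finset.sum_sub_distrib,
      Fintype.sum_equiv (Equiv.mulLeft (AlgEquiv.restrictNormalHom L σ))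
        (fun x => a (s (AlgEquiv.restrictNormalHom L σ * x))) (fun x => a (s x)) fun _ => rfl]
    simp [hndef]
  rw [map_neg, map_mul, map_inv₀, map_natCast, h1]
  field_simp
  ring

/-- Multiplicative Hilbert 90 for continuous cocycles of a Galois group. -/
theorem exists_mul_eq_of_isLocallyConstant {f : Gal(K/k) → K} (hf : IsLocallyConstant f)
    (hne : ∀ σ, f σ ≠ 0) (hmul : ∀ σ τ, f (σ * τ) = f σ * σ (f τ)) :
    ∃ g, g ≠ 0 ∧ ∀ σ, f σ * g = σ g := by
  obtain ⟨L, hfin, hnor, hL⟩ := hf.exists_finite_normal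
  choose s hs using AlgEquiv.restrictNormalHom_surjective (F := k) (K₁ := L) K
  have hs' (x : Gal(L/k)) (z : L) : s x z = x z := by
    conv_rhs => rw [← hs x]
    exact (AlgEquiv.restrictNormal_commutes (s x) L z).symm
  have hli : LinearIndependent K (fun (x : Gal(L/k)) (z : L) => ((x z : L) : K)) :=
    (linearIndependent_monoidHom L K).comp
      (fun x : Gal(L/k) => ((algebraMap L K : L →* K).comp (x : L →* L)))
      (fun x y h => by ext z; exact congrArg _ (Subtype.ext (DFunLike.congr_fun h z)))
  -- Dedekind independence gives `z` with nonzero Poincaré sum `b = ∑ f(s x) · s x z`. Since `f σ ·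
  -- σ b = b`, the required element is `b⁻¹`.
  obtain ⟨z, hz⟩ : ∃ z : L, ∑ x : Gal(L/k), f (s x) * s x z ≠ 0 := by
    by_contra! h
    refine hne (s 1) (Fintype.linearIndependent_iff.1 hli (fun x => f (s x)) ?_ 1)
    funext z
    simpa [hs'] using h z
  refine ⟨(∑ x : Gal(L/k), f (s x) * s x z)⁻¹, inv_ne_zero hz, fun σ => ?_⟩
  have h1 : f σ * σ (∑ x : Gal(L/k), f (s x) * s x z) = ∑ x : Gal(L/k), f (s x) * s x z := by
    have h2 (x : Gal(L/k)) : f σ * σ (f (s x) * s x z) =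
        f (s (AlgEquiv.restrictNormalHom L σ * x)) *
          s (AlgEquiv.restrictNormalHom L σ * x) z := by
      rw [hL (s (AlgEquiv.restrictNormalHom L σ * x)) (σ * s x) (by simp [hs]), hmul, map_mul,
        hs', hs', AlgEquiv.mul_apply, mul_assoc]
      congr 2
      exact (AlgEquiv.restrictNormal_commutes σ L (x z)).symm
    rw [map_sum, Finset.mul_sum, Finset.sum_congr rfl fun x _ => h2 x]
    exact Fintype.sum_equiv (Equiv.mulLeft (AlgEquiv.restrictNormalHom L σ)) _ _ fun _ => rfl
  rw [map_inv₀]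
  apply eq_inv_of_mul_eq_one_left
  rw [mul_right_comm, h1, mul_inv_cancel₀ hz]

/-- Over a `C₁`-field `k`, every continuous `2`-cocycle of the Galois group with values in `kˣ`
becomes the coboundary of a continuous cochain with values in `Kˣ`. -/
theorem exists_continuous_trivialization_of_isC1Field (hk : IsC1Field k)
    {c : Gal(K/k) × Gal(K/k) → k} (hcont : IsLocallyConstant c) (hc : ∀ p, c p ≠ 0)
    (hcocycle : ∀ σ τ ρ, c (σ * τ, ρ) * c (σ, τ) = c (τ, ρ) * c (σ, τ * ρ)) :
    ∃ f : Gal(K/k) → K, IsLocallyConstant f ∧ (∀ σ, f σ ≠ 0) ∧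
      ∀ σ τ, f (σ * τ) = algebraMap k K (c (σ, τ)) * (f σ * σ (f τ)) := by
  obtain ⟨L, hfin, hnor, hL⟩ := hcont.exists_finite_normal_prod
  have : IsGalois k L := ⟨⟩
  choose s hs using AlgEquiv.restrictNormalHom_surjective (F := k) (K₁ := L) K
  have hres (σ τ : Gal(K/k)) : c (s (AlgEquiv.restrictNormalHom L σ),
      s (AlgEquiv.restrictNormalHom L τ)) = c (σ, τ) := hL _ _ _ _ (hs _) (hs _)
  -- The lifts multiply correctly modulo the kernel of restriction, which suffices for `c` to
  -- descend to a cocycle on `Gal(L/k)`.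
  have hresmul (σ τ : Gal(L/k)) : AlgEquiv.restrictNormalHom L (s (σ * τ)) =
      AlgEquiv.restrictNormalHom L (s σ * s τ) := by simp [hs]
  obtain ⟨f, hf, hmul⟩ := exists_trivialization_of_isC1Field (L := L) hk
    (fun σ τ => c (s σ, s τ)) (fun _ _ => hc _) (fun σ τ ρ => by
      rw [hL (s (σ * τ)) (s ρ) (s σ * s τ) (s ρ) (hresmul _ _) rfl,
        hL (s σ) (s (τ * ρ)) (s σ) (s τ * s ρ) rfl (hresmul _ _)]
      exact hcocycle _ _ _)
  refine ⟨fun σ => (f (AlgEquiv.restrictNormalHom L σ) : K),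
    isLocallyConstant_comp_restrictNormalHom L fun x => (f x : K),
    fun σ h => hf _ (by simpa using h), fun σ τ => ?_⟩
  have h := congrArg (algebraMap L K) (hmul (AlgEquiv.restrictNormalHom L σ)
    (AlgEquiv.restrictNormalHom L τ))
  rw [← map_mul, map_mul (algebraMap L K), map_mul (algebraMap L K), hres,
    ← IsScalarTower.algebraMap_apply] at h
  refine h.trans ?_
  congr 2
  exact AlgEquiv.restrictNormal_commutes σ L _

end ContinuousCochains

/-! ### Constants of algebraic extensions. -/

section Constants

open Polynomial Differential

/-- Over a differential field with algebraically closed field of constants, an algebraic extension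
has no new constants. -/
theorem exists_constantField_of_deriv_eq_zero {k : Type u} {K : Type v} [Field k] [Differential k]
    [IsAlgClosed (constantField k)] [Field K] [Differential K] [Algebra k K]
    [DifferentialAlgebra k K] [Algebra.IsIntegral k K] {x : K} (hx : x′ = 0) :
    ∃ c : constantField k, algebraMap k K c = x := by
  have hint : IsIntegral k x := Algebra.IsIntegral.isIntegral x
  set p := minpoly k x
  have hmonic : p.Monic := minpoly.monic hint
  -- Since `x′ = 0`, differentiating the coefficients of `p` gives a polynomial that still kills
  -- `x`. Its degree is smaller because `p` is monic, so it is zero and `p` has constant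
  -- coefficients.
  have hzero : mapCoeffs p = 0 := by
    by_contra hne
    have hdvd : p ∣ mapCoeffs p := minpoly.dvd k x <| by
      have h := deriv_aeval_eq x p
      rwa [minpoly.aeval, map_zero, hx, mul_zero, add_zero, eq_comm] at h
    refine hne (eq_zero_of_dvd_of_degree_lt hdvd ?_)
    rw [degree_eq_natDegree hmonic.ne_zero, degree_lt_iff_coeff_zero]
    intro m hm
    rw [coeff_mapCoeffs]
    rcases hm.eq_or_lt with rfl | hlt
    · rw [hmonic.coeff_natDegree]; simp
    · rw [coeff_eq_zero_of_natDegree_lt hlt, map_zero]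
  have hlift : p ∈ lifts (algebraMap (constantField k) k) := by
    rw [lifts_iff_coeff_lifts]
    intro n
    have hn : (p.coeff n)′ = 0 := by rw [← coeff_mapCoeffs, hzero, coeff_zero]
    exact ⟨⟨p.coeff n, hn⟩, rfl⟩
  obtain ⟨q, hq, hdeg, -⟩ := lifts_and_degree_eq_and_monic hlift hmonic
  have hirr : Irreducible p := minpoly.irreducible hint
  -- A constant root `r` of the irreducible `p` makes `p` associated to `X - r`, whence `x = r`.
  obtain ⟨r, hr⟩ := IsAlgClosed.exists_root q
    (by rw [hdeg]; exact (degree_pos_of_irreducible hirr).ne')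
  have hroot : p.IsRoot (r : k) := by
    rw [← hq]
    exact hr.map
  have hdvd : p ∣ X - C (r : k) :=
    ((irreducible_X_sub_C (r : k)).associated_of_dvd hirr (dvd_iff_isRoot.2 hroot)).symm.dvd
  have h0 := aeval_eq_zero_of_dvd_aeval_eq_zero hdvd (minpoly.aeval k x)
  rw [map_sub, aeval_X, aeval_C, sub_eq_zero] at h0
  exact ⟨r, h0.symm⟩

end Constants

/-! ### Obstruction cochains and cocycles of one-dimensional modules. -/

namespace DifferentialModule

open Differential

/-- An isomorphism is multiplication by the image `g` of the generator, and compatibility with `∂`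
says `g′ = (u - v) g`. -/
theorem elemClass_eq_iff {K : Type u} [Field K] [Differential K] {u v : K} :
    elemClass u = elemClass v ↔ ∃ g : K, g ≠ 0 ∧ logDeriv g = u - v := by
  unfold elemClass
  rw [rankOneClass_eq_iff]
  constructor
  · rintro ⟨φ⟩
    let e : K ≃ₗ[K] K := φ.toEquiv
    have hD : e (ofElemD u 1) = ofElemD v (e 1) := φ.map_D (1 : K)
    have hg : e 1 ≠ 0 := fun h => one_ne_zero (e.map_eq_zero_iff.1 h)
    refine ⟨e 1, hg, ?_⟩
    have hu : e u = u * e 1 := by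
      conv_lhs => rw [← mul_one u, ← smul_eq_mul, map_smul, smul_eq_mul]
    rw [ofElemD_apply, ofElemD_apply, Derivation.map_one_eq_zero, zero_add, one_mul, hu] at hD
    rw [Differential.logDeriv, div_eq_iff hg]
    linear_combination -hD
  · rintro ⟨g, hg, h⟩
    rw [Differential.logDeriv, div_eq_iff hg] at h
    have hD (x : K) : LinearEquiv.smulOfUnit (M := K) (Units.mk0 g hg) (ofElemD u x) =
        ofElemD v (LinearEquiv.smulOfUnit (M := K) (Units.mk0 g hg) x) := by
      change g * (x′ + x * u) = (g * x)′ + (g * x) * v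
      rw [Derivation.leibniz, smul_eq_mul, smul_eq_mul, h]
      ring
    exact ⟨⟨LinearEquiv.smulOfUnit (M := K) (Units.mk0 g hg), hD⟩⟩

section Obstruction

variable {k : Type u} {K : Type v} [Field k] [Field K] [Differential k] [Algebra k K]

theorem algebraMap_constantField_ne_zero (γ : (constantField k)ˣ) :
    algebraMap k K (γ : constantField k) ≠ 0 := by
  simp

theorem algebraMap_units_constantField_injective :
    Function.Injective fun γ : (constantField k)ˣ => algebraMap k K (γ : constantField k) :=
  fun _ _ h => Units.ext (Subtype.ext ((algebraMap k K).injective h))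

variable [Differential K]

/-- `f` is a continuous cochain with logarithmic derivative `σ ↦ σ u - u` and with defect `c` from
being a cocycle. -/
structure IsObstructionCochain (u : K) (c : Gal(K/k) × Gal(K/k) → (constantField k)ˣ)
    (f : Gal(K/k) → K) : Prop where
  isLocallyConstant : IsLocallyConstant f
  ne_zero : ∀ σ, f σ ≠ 0
  logDeriv_eq : ∀ σ, logDeriv (f σ) = σ u - u
  map_mul : ∀ σ τ, f (σ * τ) = algebraMap k K (c (σ, τ) : constantField k) * (f σ * σ (f τ))

theorem IsObstructionCochain.mul {u v : K} {c d : Gal(K/k) × Gal(K/k) → (constantField k)ˣ}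
    {f g : Gal(K/k) → K} (hf : IsObstructionCochain u c f) (hg : IsObstructionCochain v d g) :
    IsObstructionCochain (u + v) (c * d) (f * g) where
  isLocallyConstant := hf.isLocallyConstant.mul hg.isLocallyConstant
  ne_zero σ := mul_ne_zero (hf.ne_zero σ) (hg.ne_zero σ)
  logDeriv_eq σ := by
    rw [Pi.mul_apply, logDeriv_mul _ _ (hf.ne_zero σ) (hg.ne_zero σ), hf.logDeriv_eq,
      hg.logDeriv_eq, map_add]
    ring
  map_mul σ τ := by
    simp only [Pi.mul_apply, hf.map_mul, hg.map_mul, Units.val_mul, _root_.map_mul,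
      Subfield.coe_mul]
    ring

theorem isObstructionCochain_algebraMap (b : k) :
    IsObstructionCochain (algebraMap k K b) (1 : Gal(K/k) × Gal(K/k) → (constantField k)ˣ) 1 where
  isLocallyConstant := IsLocallyConstant.const 1
  ne_zero _ := one_ne_zero
  logDeriv_eq σ := by simp
  map_mul σ τ := by simp

/-- Conjugate each `Φ σ` by the isomorphism. -/
theorem IsObstructionCocycle.of_iso [IsGalois k K] {A : DifferentialModule.{v, w₁} K}
    {B : DifferentialModule.{v, w₂} K}
    (e : Iso A B) {c : Gal(K/k) × Gal(K/k) → (constantField k)ˣ} (h : IsObstructionCocycle A c) :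
    IsObstructionCocycle B c := by
  obtain ⟨Φ, hsmul, hD, hloc, hmul⟩ := h
  have hDsymm (b : B) : e.toEquiv.symm (B.D b) = A.D (e.toEquiv.symm b) := e.symm.map_D b
  refine ⟨fun σ => (e.toEquiv.symm.toAddEquiv.trans (Φ σ)).trans e.toEquiv.toAddEquiv,
    fun σ x b => ?_, fun σ b => ?_, fun b => ?_, fun σ τ b => ?_⟩
  · change e.toEquiv (Φ σ (e.toEquiv.symm (x • b))) = σ x • e.toEquiv (Φ σ (e.toEquiv.symm b))
    rw [_root_.map_smul, hsmul, _root_.map_smul]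
  · change e.toEquiv (Φ σ (e.toEquiv.symm (B.D b))) = B.D (e.toEquiv (Φ σ (e.toEquiv.symm b)))
    rw [hDsymm, hD, e.map_D]
  · exact (hloc (e.toEquiv.symm b)).comp e.toEquiv
  · change e.toEquiv (Φ (σ * τ) (e.toEquiv.symm b)) =
      _ • e.toEquiv (Φ σ (e.toEquiv.symm (e.toEquiv (Φ τ (e.toEquiv.symm b)))))
    rw [hmul, _root_.map_smul, e.toEquiv.symm_apply_apply]

variable [DifferentialAlgebra k K]

theorem deriv_algebraMap_constantField (γ : constantField k) :
    (algebraMap k K (γ : k))′ = 0 := by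
  have h : (γ : k)′ = 0 := γ.2
  rw [deriv_algebraMap, h, map_zero]

variable [IsGalois k K]

theorem logDeriv_algEquiv (σ : Gal(K/k)) (x : K) :
    Differential.logDeriv (σ x) = σ (Differential.logDeriv x) := by
  rw [Differential.logDeriv, Differential.logDeriv, map_div₀, algEquiv_deriv']

/-- A `σ`-linear map of `K e` is `a ↦ σ(a) f(σ)` with `f(σ)` the image of `1`. Commuting with `∂` is
then the condition on `dlog f(σ)`. -/
theorem isObstructionCocycle_ofElem_iff {u : K}
    {c : Gal(K/k) × Gal(K/k) → (constantField k)ˣ} :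
    IsObstructionCocycle (ofElem u) c ↔ ∃ f, IsObstructionCochain u c f := by
  constructor
  · rintro ⟨Φ', hsmul', hD', hloc', hmul'⟩
    let Φ : Gal(K/k) → K ≃+ K := Φ'
    have hsmul (σ : Gal(K/k)) (x a : K) : Φ σ (x * a) = σ x * Φ σ a := hsmul' σ x a
    have hD (σ : Gal(K/k)) (a : K) : Φ σ (ofElemD u a) = ofElemD u (Φ σ a) := hD' σ a
    have hloc (a : K) : IsLocallyConstant fun σ => Φ σ a := hloc' a
    have hmul (σ τ : Gal(K/k)) (a : K) : Φ (σ * τ) a =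
      algebraMap k K (c (σ, τ) : constantField k) * Φ σ (Φ τ a) := hmul' σ τ a
    have hΦ (σ : Gal(K/k)) (a : K) : Φ σ a = σ a * Φ σ 1 := by
      rw [← hsmul, mul_one]
    have hne (σ : Gal(K/k)) : Φ σ 1 ≠ 0 := fun h => one_ne_zero ((Φ σ).map_eq_zero_iff.1 h)
    refine ⟨fun σ => Φ σ 1, hloc 1, hne, fun σ => ?_, fun σ τ => ?_⟩
    · have h := hD σ 1
      rw [ofElemD_apply, ofElemD_apply, Derivation.map_one_eq_zero, zero_add, one_mul, hΦ] at h
      rw [Differential.logDeriv, div_eq_iff (hne σ)]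
      linear_combination -h
    · rw [hmul, hΦ σ (Φ τ 1), mul_comm (σ _)]
  · rintro ⟨f, hf⟩
    let Φ (σ : Gal(K/k)) : K ≃+ K := σ.toAddEquiv.trans
      (LinearEquiv.smulOfUnit (R := K) (M := K) (Units.mk0 (f σ) (hf.ne_zero σ))).toAddEquiv
    have hΦ (σ : Gal(K/k)) (a : K) : Φ σ a = f σ * σ a := rfl
    have h1 (σ : Gal(K/k)) (x a : K) : Φ σ (x * a) = σ x * Φ σ a := by
      rw [hΦ, hΦ, _root_.map_mul]; ring
    have h2 (σ : Gal(K/k)) (a : K) : Φ σ (ofElemD u a) = ofElemD u (Φ σ a) := by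
      have h := hf.logDeriv_eq σ
      rw [Differential.logDeriv, div_eq_iff (hf.ne_zero σ)] at h
      rw [hΦ, hΦ, ofElemD_apply, ofElemD_apply, Derivation.leibniz, h, _root_.map_add,
        _root_.map_mul, algEquiv_deriv', smul_eq_mul, smul_eq_mul]
      ring
    have h3 (a : K) : IsLocallyConstant fun σ => Φ σ a :=
      hf.isLocallyConstant.mul (isLocallyConstant_apply a)
    have h4 (σ τ : Gal(K/k)) (a : K) : Φ (σ * τ) a =
        algebraMap k K (c (σ, τ) : constantField k) * Φ σ (Φ τ a) := by
      rw [hΦ, hΦ, hΦ, hf.map_mul, _root_.map_mul, AlgEquiv.mul_apply]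
      ring
    exact ⟨Φ, h1, h2, h3, h4⟩

theorem IsObstructionCochain.of_elemClass_eq {u v : K} (huv : elemClass u = elemClass v)
    {c : Gal(K/k) × Gal(K/k) → (constantField k)ˣ} {f : Gal(K/k) → K}
    (hf : IsObstructionCochain u c f) : ∃ f', IsObstructionCochain v c f' := by
  obtain ⟨φ⟩ := rankOneClass_eq_iff.1 huv
  exact isObstructionCocycle_ofElem_iff.1
    ((isObstructionCocycle_ofElem_iff.2 ⟨f, hf⟩).of_iso φ)

/-- Over a `C₁`-field, every continuous `2`-cocycle is an obstruction cocycle. -/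
theorem exists_isObstructionCochain_of_isC1Field [CharZero k] (hk : IsC1Field k)
    {c : Gal(K/k) × Gal(K/k) → (constantField k)ˣ}
    (hc : c ∈ contTwoCocycles Gal(K/k) (constantField k)ˣ) :
    ∃ u f, IsObstructionCochain (K := K) u c f := by
  obtain ⟨f, hloc, hne, hmul⟩ := exists_continuous_trivialization_of_isC1Field (K := K) hk
    (c := fun p => (c p : constantField k)) (hc.1.comp fun γ : (constantField k)ˣ => (γ : k))
    (fun p => by simp)
    (fun σ τ ρ => by exact_mod_cast congrArg (fun γ : (constantField k)ˣ => (γ : k)) (hc.2 σ τ ρ))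
  -- The factor `c` is constant and disappears under `logDeriv`, so `logDeriv ∘ f` is a genuine
  -- additive cocycle.
  obtain ⟨u, hu⟩ := exists_eq_sub_of_isLocallyConstant (hloc.comp logDeriv) fun σ τ => by
    have hσ : σ (f τ) ≠ 0 := (map_ne_zero σ).2 (hne τ)
    have h0 := algebraMap_constantField_ne_zero (K := K) (c (σ, τ))
    simp only [Function.comp_apply]
    rw [hmul, logDeriv_mul _ _ h0 (mul_ne_zero (hne σ) hσ), logDeriv_mul _ _ (hne σ) hσ,
      (logDeriv_eq_zero _).2 (deriv_algebraMap_constantField _), zero_add,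
      logDeriv_algEquiv]
  exact ⟨u, f, hloc, hne, fun σ => (hu σ), hmul⟩

/-- An element with trivial obstruction class is equivalent to an element of the base field. -/
theorem IsObstructionCochain.exists_elemClass_eq {u : K}
    {c : Gal(K/k) × Gal(K/k) → (constantField k)ˣ} {f : Gal(K/k) → K}
    (hf : IsObstructionCochain u c f)
    (hc : c ∈ contTwoCoboundaries Gal(K/k) (constantField k)ˣ) :
    ∃ b : k, elemClass u = elemClass (algebraMap k K b) := by
  obtain ⟨x, hx, hxc⟩ := hc
  set y : Gal(K/k) → K := fun σ => algebraMap k K (x σ : constantField k) with hy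
  have hyne (σ : Gal(K/k)) : y σ ≠ 0 := algebraMap_constantField_ne_zero _
  have hyc (σ τ : Gal(K/k)) :
      y τ * y σ = algebraMap k K (c (σ, τ) : constantField k) * y (σ * τ) := by
    have h := hxc σ τ
    rw [div_mul_eq_mul_div, div_eq_iff_eq_mul] at h
    simpa using congrArg (fun γ : (constantField k)ˣ => algebraMap k K (γ : constantField k)) h
  have hylog (σ : Gal(K/k)) : logDeriv (y σ) = 0 :=
    (logDeriv_eq_zero _).2 (deriv_algebraMap_constantField _)
  -- Scaling `f` by the constants `x` cancels `c`, leaving a multiplicative cocycle.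
  obtain ⟨g, hg, hgf⟩ := exists_mul_eq_of_isLocallyConstant (k := k)
    (hf.isLocallyConstant.mul
      (hx.comp fun γ : (constantField k)ˣ => algebraMap k K (γ : constantField k)))
    (fun σ => mul_ne_zero (hf.ne_zero σ) (hyne σ)) (fun σ τ => by
      change f (σ * τ) * y (σ * τ) = f σ * y σ * σ (f τ * y τ)
      have hσ : σ (y τ) = y τ := σ.commutes _
      rw [hf.map_mul, _root_.map_mul, hσ]
      linear_combination -(f σ * σ (f τ)) * hyc σ τ)
  have hfix : ∀ σ : Gal(K/k), σ (u - logDeriv g) = u - logDeriv g := fun σ => by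
    have h := congrArg Differential.logDeriv (hgf σ)
    change logDeriv (f σ * y σ * g) = _ at h
    rw [logDeriv_mul _ _ (mul_ne_zero (hf.ne_zero σ) (hyne σ)) hg,
      logDeriv_mul _ _ (hf.ne_zero σ) (hyne σ), hylog, hf.logDeriv_eq] at h
    rw [map_sub, ← logDeriv_algEquiv, ← h]
    ring
  obtain ⟨b, hb⟩ := (InfiniteGalois.mem_range_algebraMap_iff_fixed _).2 hfix
  exact ⟨b, elemClass_eq_iff.2 ⟨g, hg, by rw [hb]; ring⟩⟩

variable [IsAlgClosed (constantField k)]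

theorem exists_units_constantField {x : K} (hx : x ≠ 0) (hd : logDeriv x = 0) :
    ∃ γ : (constantField k)ˣ, algebraMap k K (γ : constantField k) = x := by
  obtain ⟨γ, rfl⟩ := exists_constantField_of_deriv_eq_zero (k := k) ((logDeriv_eq_zero x).1 hd)
  have hγ : γ ≠ 0 := by
    rintro rfl
    simp at hx
  exact ⟨Units.mk0 γ hγ, rfl⟩

/-- An element whose class is invariant has an obstruction cocycle. -/
theorem exists_isObstructionCochain {u : K}
    (hu : ∀ σ : Gal(K/k), elemClass (σ u) = elemClass u) :
    ∃ c ∈ contTwoCocycles Gal(K/k) (constantField k)ˣ, ∃ f, IsObstructionCochain u c f := by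
  classical
  simp only [elemClass_eq_iff] at hu
  -- The solution is chosen as a function of `σ u` rather than of `σ`, so that `f` inherits local
  -- constancy from `σ ↦ σ u`. The default `1` is never reached at a conjugate of `u`.
  let F (x : K) : K := if h : ∃ g : K, g ≠ 0 ∧ logDeriv g = x - u then h.choose else 1
  have hF (σ : Gal(K/k)) : F (σ u) ≠ 0 ∧ logDeriv (F (σ u)) = σ u - u := by
    simp only [F, dif_pos (hu σ)]
    exact (hu σ).choose_spec
  set f : Gal(K/k) → K := fun σ => F (σ u) with hfdef
  have hloc : IsLocallyConstant f := (isLocallyConstant_apply u).comp F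
  have hne (σ : Gal(K/k)) : f σ ≠ 0 := (hF σ).1
  have hne' (σ τ : Gal(K/k)) : σ (f τ) ≠ 0 := (map_ne_zero σ).2 (hne τ)
  have hlog (σ : Gal(K/k)) : logDeriv (f σ) = σ u - u := (hF σ).2
  have hlog' (σ τ : Gal(K/k)) : logDeriv (σ (f τ)) = σ (τ u) - σ u := by
    rw [← map_sub, ← hlog, logDeriv_algEquiv]
  have hex (p : Gal(K/k) × Gal(K/k)) : ∃ γ : (constantField k)ˣ,
      algebraMap k K (γ : constantField k) = f (p.1 * p.2) / (f p.1 * p.1 (f p.2)) := by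
    refine exists_units_constantField
      (div_ne_zero (hne _) (mul_ne_zero (hne _) (hne' _ _))) ?_
    rw [logDeriv_div _ _ (hne _) (mul_ne_zero (hne _) (hne' _ _)),
      logDeriv_mul _ _ (hne _) (hne' _ _), hlog, hlog, hlog', AlgEquiv.mul_apply]
    ring
  choose c hc using hex
  have hmul (σ τ : Gal(K/k)) :
      f (σ * τ) = algebraMap k K (c (σ, τ) : constantField k) * (f σ * σ (f τ)) := by
    rw [hc, div_mul_cancel₀ _ (mul_ne_zero (hne _) (hne' _ _))]
  refine ⟨c, ⟨?_, fun σ τ ρ => ?_⟩, f, hloc, hne, hlog, hmul⟩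
  · refine IsLocallyConstant.desc c _ ?_ (algebraMap_units_constantField_injective (K := K))
    have h : IsLocallyConstant fun p : Gal(K/k) × Gal(K/k) =>
        f (p.1 * p.2) / (f p.1 * p.1 (f p.2)) :=
      (hloc.comp_continuous continuous_mul).div
        ((hloc.comp_continuous continuous_fst).mul (isLocallyConstant_apply_apply hloc))
    convert h using 2 with p
    exact hc p
  -- The cocycle identity comes from expanding `f(στρ)` in two ways; `Gal(K/k)` fixes the values of
  -- `c`.
  · apply algebraMap_units_constantField_injective (K := K)
    simp only [Units.val_mul, Subfield.coe_mul, _root_.map_mul]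
    have h1 := hmul (σ * τ) ρ
    have h2 := hmul σ (τ * ρ)
    rw [hmul σ τ] at h1
    rw [hmul τ ρ, _root_.map_mul, _root_.map_mul, AlgEquiv.commutes, ← mul_assoc σ τ, h1,
      AlgEquiv.mul_apply] at h2
    have h0 : f σ * (σ (f τ) * σ (τ (f ρ))) ≠ 0 :=
      mul_ne_zero (hne _) (mul_ne_zero (hne' _ _) ((map_ne_zero σ).2 (hne' _ _)))
    apply mul_right_cancel₀ h0
    linear_combination h2

/-- The class of the obstruction cocycle is well-defined. -/
theorem IsObstructionCochain.div_mem_contTwoCoboundaries {u : K}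
    {c d : Gal(K/k) × Gal(K/k) → (constantField k)ˣ} {f g : Gal(K/k) → K}
    (hf : IsObstructionCochain u c f) (hg : IsObstructionCochain u d g) :
    c⁻¹ * d ∈ contTwoCoboundaries Gal(K/k) (constantField k)ˣ := by
  -- Both cochains have the same logarithmic derivative, so `f / g` is a `C*`-valued cochain; its
  -- coboundary is `c⁻¹ d`.
  have hex (σ : Gal(K/k)) : ∃ γ : (constantField k)ˣ,
      algebraMap k K (γ : constantField k) = f σ / g σ := by
    refine exists_units_constantField (div_ne_zero (hf.ne_zero σ) (hg.ne_zero σ)) ?_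
    rw [logDeriv_div _ _ (hf.ne_zero σ) (hg.ne_zero σ), hf.logDeriv_eq, hg.logDeriv_eq, sub_self]
  choose x hx using hex
  refine ⟨x, ?_, fun σ τ => ?_⟩
  · refine IsLocallyConstant.desc x _ ?_ (algebraMap_units_constantField_injective (K := K))
    convert hf.isLocallyConstant.div hg.isLocallyConstant using 1
    funext σ
    exact hx σ
  · rw [div_mul_eq_mul_div, div_eq_iff_eq_mul, Pi.mul_apply, Pi.inv_apply, mul_assoc,
      eq_inv_mul_iff_mul_eq]
    apply algebraMap_units_constantField_injective (K := K)
    have hτ : algebraMap k K (x τ : constantField k) = σ (f τ) / σ (g τ) := by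
      rw [← map_div₀, ← hx, AlgEquiv.commutes]
    simp only [Units.val_mul, Subfield.coe_mul, _root_.map_mul]
    rw [hτ, hx, hx, hf.map_mul, hg.map_mul]
    have h1 := hg.ne_zero σ
    have h2 := (map_ne_zero σ).2 (hg.ne_zero τ)
    have h3 := algebraMap_constantField_ne_zero (K := K) (d (σ, τ))
    field_simp

end Obstruction

end DifferentialModule

/-! ### The obstruction homomorphism, its kernel and its image. -/

namespace DifferentialModule

section ClassMap

variable {k : Type u} {K : Type v} [Field k] [Field K] [Differential k] [Differential K]
  [Algebra k K]

/-- `c` is an obstruction cocycle of some element representing the class `x`. -/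
def IsClassCocycle (x : RankOneClass K) (c : Gal(K/k) × Gal(K/k) → (constantField k)ˣ) : Prop :=
  ∃ u f, x = elemClass u ∧ IsObstructionCochain u c f

theorem IsClassCocycle.mul {x y : RankOneClass K}
    {c d : Gal(K/k) × Gal(K/k) → (constantField k)ˣ} (hc : IsClassCocycle x c)
    (hd : IsClassCocycle y d) : IsClassCocycle (x * y) (c * d) := by
  obtain ⟨u, f, rfl, hf⟩ := hc
  obtain ⟨v, g, rfl, hg⟩ := hd
  exact ⟨u + v, f * g, elemClass_mul u v, hf.mul hg⟩

variable [DifferentialAlgebra k K]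

theorem mem_descendedClasses_iff {x : RankOneClass K} :
    x ∈ descendedClasses k K ↔ ∃ b : k, x = elemClass (algebraMap k K b) := by
  constructor
  · rintro ⟨A, hA, rfl, B, hB, ⟨φ⟩⟩
    obtain ⟨b, ⟨e⟩⟩ := exists_iso_ofElem B hB
    exact ⟨b, rankOneClass_eq_iff.2
      ⟨φ.trans (e.symm.baseChange.trans (baseChangeOfElem b))⟩⟩
  · rintro ⟨b, rfl⟩
    exact ⟨ofElem (algebraMap k K b), finrank_ofElem _, rfl, ofElem b, finrank_ofElem b,
      ⟨(baseChangeOfElem b).symm⟩⟩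

variable [IsGalois k K]

theorem mem_invariantClasses_iff {x : RankOneClass K} :
    x ∈ invariantClasses k K ↔
      ∃ u, x = elemClass u ∧ ∀ σ : Gal(K/k), elemClass (σ u) = elemClass u := by
  constructor
  · rintro ⟨A, hA, rfl, h⟩
    obtain ⟨u, ⟨φ⟩⟩ := exists_iso_ofElem A hA
    exact ⟨u, rankOneClass_eq_iff.2 ⟨φ.symm⟩, fun σ => (twist_iso_iff k K φ σ).1 (h σ)⟩
  · rintro ⟨u, rfl, h⟩
    exact ⟨ofElem u, finrank_ofElem u, rfl, fun σ => (twist_iso_iff k K (Iso.refl _) σ).2 (h σ)⟩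

variable (k K) in
theorem descendedClasses_le_invariantClasses : descendedClasses k K ≤ invariantClasses k K := by
  intro x hx
  obtain ⟨b, rfl⟩ := mem_descendedClasses_iff.1 hx
  exact mem_invariantClasses_iff.2 ⟨_, rfl, fun σ => by rw [AlgEquiv.commutes]⟩

/-- Passes between the intrinsic maps `Φ σ` on a module and the cochains attached to an element `u`.
-/
theorem isClassCocycle_iff {A : DifferentialModule.{v, v} K} (hA : Module.finrank K A = 1)
    {c : Gal(K/k) × Gal(K/k) → (constantField k)ˣ} :
    IsClassCocycle (rankOneClass A hA) c ↔ IsObstructionCocycle A c := by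
  constructor
  · rintro ⟨u, f, hu, hf⟩
    obtain ⟨φ⟩ := rankOneClass_eq_iff.1 hu
    exact (isObstructionCocycle_ofElem_iff.2 ⟨f, hf⟩).of_iso φ.symm
  · intro h
    obtain ⟨u, ⟨φ⟩⟩ := exists_iso_ofElem A hA
    obtain ⟨f, hf⟩ := isObstructionCocycle_ofElem_iff.1 (h.of_iso φ.symm)
    exact ⟨u, f, rankOneClass_eq_iff.2 ⟨φ.symm⟩, hf⟩

/-- The value `f σ` itself gives the isomorphism between `A` and its twist. -/
theorem IsClassCocycle.mem_invariantClasses {x : RankOneClass K}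
    {c : Gal(K/k) × Gal(K/k) → (constantField k)ˣ} (h : IsClassCocycle x c) :
    x ∈ invariantClasses k K := by
  obtain ⟨u, f, rfl, hf⟩ := h
  exact mem_invariantClasses_iff.2
    ⟨u, rfl, fun σ => elemClass_eq_iff.2 ⟨f σ, hf.ne_zero σ, hf.logDeriv_eq σ⟩⟩

variable [IsAlgClosed (constantField k)]

theorem exists_isClassCocycle (x : invariantClasses k K) :
    ∃ c : contTwoCocycles Gal(K/k) (constantField k)ˣ, IsClassCocycle (x : RankOneClass K) c.1 := by
  obtain ⟨u, hx, hu⟩ := mem_invariantClasses_iff.1 x.2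
  obtain ⟨c, hc, f, hf⟩ := exists_isObstructionCochain hu
  exact ⟨⟨c, hc⟩, u, f, hx, hf⟩

/-- The two cochains may belong to different representatives; the second is moved to the first
representative before comparison. This makes the obstruction class independent of all choices. -/
theorem IsClassCocycle.mk_eq {x : RankOneClass K}
    {c d : contTwoCocycles Gal(K/k) (constantField k)ˣ} (hc : IsClassCocycle x c.1)
    (hd : IsClassCocycle x d.1) :
    (QuotientGroup.mk c : ContH2 Gal(K/k) (constantField k)ˣ) = QuotientGroup.mk d := by
  obtain ⟨u, f, rfl, hf⟩ := hc
  obtain ⟨v, g, huv, hg⟩ := hd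
  obtain ⟨g', hg'⟩ := hg.of_elemClass_eq huv.symm
  exact QuotientGroup.eq.2 (hf.div_mem_contTwoCoboundaries hg')

set_option synthInstance.maxHeartbeats 200000 in
variable (k K) in
/-- The homomorphism sending an invariant class to the class of its obstruction cocycles. -/
noncomputable def obstructionHom :
    invariantClasses k K →* ContH2 Gal(K/k) (constantField k)ˣ :=
  MonoidHom.mk' (fun x => QuotientGroup.mk (exists_isClassCocycle x).choose) fun x y =>
    -- The product of the cocycles chosen for `x` and `y` is another cocycle for `x * y`, so it has
    -- the same class as the chosen one.
    (exists_isClassCocycle (x * y)).choose_spec.mk_eq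
      (d := (exists_isClassCocycle x).choose * (exists_isClassCocycle y).choose)
      ((exists_isClassCocycle x).choose_spec.mul (exists_isClassCocycle y).choose_spec)

set_option synthInstance.maxHeartbeats 200000 in
theorem obstructionHom_eq {x : invariantClasses k K}
    {c : contTwoCocycles Gal(K/k) (constantField k)ˣ}
    (hc : IsClassCocycle (x : RankOneClass K) c.1) :
    obstructionHom k K x = QuotientGroup.mk c :=
  (exists_isClassCocycle x).choose_spec.mk_eq hc

-- An element of `k` has the cochain `1`, with trivial defect; the converse is the Hilbert 90
-- argument of `IsObstructionCochain.exists_elemClass_eq`.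
set_option synthInstance.maxHeartbeats 200000 in
theorem ker_obstructionHom : (descendedClasses k K).subgroupOf (invariantClasses k K) =
    (obstructionHom k K).ker := by
  ext x
  rw [Subgroup.mem_subgroupOf, MonoidHom.mem_ker, mem_descendedClasses_iff]
  constructor
  · rintro ⟨b, hb⟩
    exact obstructionHom_eq (c := 1) ⟨_, _, hb, isObstructionCochain_algebraMap b⟩
  · intro h
    obtain ⟨c, hc⟩ := exists_isClassCocycle x
    rw [obstructionHom_eq hc, QuotientGroup.eq_one_iff] at h
    obtain ⟨u, f, hx, hf⟩ := hc
    obtain ⟨b, hb⟩ := hf.exists_elemClass_eq h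
    exact ⟨b, hx.trans hb⟩

set_option synthInstance.maxHeartbeats 200000 in
theorem obstructionHom_surjective [CharZero k] (hk : IsC1Field k) :
    Function.Surjective (obstructionHom k K) := by
  intro y
  obtain ⟨c, rfl⟩ := QuotientGroup.mk_surjective y
  obtain ⟨u, f, hf⟩ := exists_isObstructionCochain_of_isC1Field (K := K) hk c.2
  have hc : IsClassCocycle (elemClass u) c.1 := ⟨u, f, rfl, hf⟩
  exact ⟨⟨elemClass u, hc.mem_invariantClasses⟩, obstructionHom_eq hc⟩

set_option synthInstance.maxHeartbeats 200000 in
/-- The isomorphism induced by `obstructionHom` over a `C₁`-field. -/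
noncomputable def obstructionEquiv [CharZero k] (hk : IsC1Field k) :
    (invariantClasses k K ⧸ (descendedClasses k K).subgroupOf (invariantClasses k K)) ≃*
      ContH2 Gal(K/k) (constantField k)ˣ :=
  QuotientGroup.liftEquiv _ (obstructionHom_surjective hk) ker_obstructionHom

end ClassMap

end DifferentialModule

open DifferentialModule in
theorem lemma4p1 {k : Type u} {K : Type v} [Field k] [CharZero k] [Differential k]
    [IsAlgClosed (constantField k)] (hk : IsC1Field k)
    [Field K] [Differential K] [Algebra k K] [DifferentialAlgebra k K] [IsGalois k K] :
    descendedClasses k K ≤ invariantClasses k K ∧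
    ∃ ψ : (invariantClasses k K ⧸ (descendedClasses k K).subgroupOf (invariantClasses k K)) ≃*
        ContH2 Gal(K/k) (constantField k)ˣ,
      ∀ (A : DifferentialModule.{v, v} K) (hA : Module.finrank K A = 1)
        (hH : rankOneClass A hA ∈ invariantClasses k K),
        (∃ c : contTwoCocycles Gal(K/k) (constantField k)ˣ, IsObstructionCocycle A c.1) ∧
        ∀ c : contTwoCocycles Gal(K/k) (constantField k)ˣ, IsObstructionCocycle A c.1 →
          ψ (QuotientGroup.mk ⟨rankOneClass A hA, hH⟩) = QuotientGroup.mk c := by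
  refine ⟨descendedClasses_le_invariantClasses k K, obstructionEquiv hk,
    fun A hA hH => ⟨?_, fun c hc => ?_⟩⟩
  · obtain ⟨c, hc⟩ := exists_isClassCocycle ⟨rankOneClass A hA, hH⟩
    exact ⟨c, (isClassCocycle_iff hA).1 hc⟩
  · exact obstructionHom_eq (x := ⟨rankOneClass A hA, hH⟩) ((isClassCocycle_iff hA).2 hc)
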